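/- **Setting.** Let $\mathcal S,\mathcal A$ be finite sets, $\gamma\in(0,1)$, $\rho\in\Delta^{\mathcal S}$, and let $c_{sas'}\in[0,1]$ be costs. Let $\Pi=(\Delta^{\mathcal A})^{\mathcal S}$, and let $\mathcal P=\prod_{s\in\mathcal S}\mathcal P_s$ be an $s$-rectangular ambiguity set of transition kernels, where each $\mathcal P_s\subseteq(\Delta^{\mathcal S})^{\mathcal A}$ is nonempty, closed and convex. Let $J_\rho(\pi,p)=\sum_s\rho_s v_s^{\pi,p}$ with $v_s^{\pi,p}=\mathbb E_{\pi,p}\big[\sum_{t\ge0}\gamma^t c_{s_ta_ts_{t+1}}\mid s_0=s\big]$. Norms are Euclidean (Frobenius). For $r_1,r_2>0$ put $$\chi(\pi,p,\bar\pi,\bar p)=J_\rho(\pi,p)+\tfrac{r_1}{2}\|\pi-\bar\pi\|^2-\tfrac{r_2}{2}\|p-\bar p\|^2 ,$$ $\varphi_\pi(p,\bar\pi,\bar p)=\min_{\pi\in\Pi}\chi$, $\varphi_{\pi,p}(\bar\pi,\bar p)=\max_{p\in\mathcal P}\varphi_\pi$, $\varphi_{\pi,p,\bar p}(\bar\pi)=\max_{\bar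 p}\varphi_{\pi,p}$ and $\underline\chi=\min_{\bar\pi}\varphi_{\pi,p,\bar p}$, where $\bar p\in\mathbb R^{\mathcal S\times\mathcal A\times\mathcal S}$ and $\bar\pi\in\mathbb R^{\mathcal S\times\mathcal A}$ are unconstrained, and $$\Phi(\pi,p,\bar\pi,\bar p)=(\chi-\varphi_\pi)+(\varphi_{\pi,p}-\varphi_\pi)+(\varphi_{\pi,p,\bar p}-\varphi_{\pi,p})+(\varphi_{\pi,p,\bar p}-\underline\chi)+\underline\chi .$$ Further let $\pi(p,\bar\pi,\bar p)=\arg\min_{\pi\in\Pi}\chi$, $p(\pi,\bar\pi,\bar p)=\arg\max_{p\in\mathcal P}\chi$, $\pi(\bar\pi,\bar p)=\arg\min_{\pi\in\Pi}\max_{p\in\mathcal P}\chi$, let $\bar p(\bar\pi)$ be any element of $\arg\max_{\bar p}\min_{\pi\in\Pi}\max_{p\in\mathcal P}\chi$, and put $$p^+(\bar\pi,\bar p)=\mathrm{proj}_{\mathcal P}\big(p+\sigma\nabla_p\chi(\pi(p,\bar\pi,\bar p),p,\bar\pi,\bar p)\big),\qquad \bar p^+(\bar\pi)=\bar p+\mu\big(p(\pi(\bar\pi,\bar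 p),\bar\pi,\bar p)-\bar p\big).$$ **Algorithm (SRPG).** Start with $\pi_0=\bar\pi_0\in\Pi$, $p_0=\bar p_0\in\mathcal P$, and iterate $$\begin{aligned}\pi_{k+1}&=\mathrm{proj}_\Pi\big(\pi_k-\tau\nabla_\pi\chi(\pi_k,p_k,\bar\pi_k,\bar p_k)\big),& p_{k+1}&=\mathrm{proj}_{\mathcal P}\big(p_k+\sigma\nabla_p\chi(\pi_{k+1},p_k,\bar\pi_k,\bar p_k)\big),\\ \bar\pi_{k+1}&=\bar\pi_k+\beta(\pi_{k+1}-\bar\pi_k),& \bar p_{k+1}&=\bar p_k+\mu(p_{k+1}-\bar p_k).\end{aligned}$$ **Proposition.** There are constants $\ell_{\pi p},\ell_{p\pi}>0$ such that, for all $\pi,\pi'\in\Pi$ and $p,p'\in\mathcal P$, $$\begin{aligned}\|\nabla_\pi J_\rho(\pi,p)-\nabla_\pi J_\rho(\pi',p')\|&\le\ell_{\pi p}(\|\pi-\pi'\|+\|p-p'\|),\\ \|\nabla_pJ_\rho(\pi,p)-\nabla_pJ_\rho(\pi',p')\|&\le\ell_{p\pi}(\|\pi-\pi'\|+\|p-p'\|).\end{aligned}$$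 For any such constants, write $L=\ell_{\pi p}$, $\ell_{p\pi}=\lambda L$, $\kappa_1=\frac{\lambda L+r_1-L}{r_1-L}$, $L_{\phi\pi}=\lambda L\kappa_1+\lambda L+r_2$, $\kappa_6=\frac{2\tau r_1+1}{\tau(r_1-L)}$, and assume $r_1\ge2L$, $r_2\ge2\lambda L$, $$0<\tau\le\min\Big\{\tfrac{4}{3(L+r_1)},\tfrac1{6\lambda L}\Big\},\qquad 0<\sigma\le\min\Big\{\tfrac{2}{3\lambda L\kappa_6^2},\tfrac1{6L_{\phi\pi}},\tfrac1{5\lambda\sqrt{\lambda+5}\,L}\Big\},$$ $$0<\beta\le\min\Big\{\tfrac{24r_1}{360r_1+5r_1^2\lambda+(2\lambda L+5r_1)^2},\tfrac{\sigma\lambda^2L^2}{384r_1(\lambda+5)(\lambda+1)^2}\Big\},$$ $$0<\mu\le\min\Big\{\tfrac{\lambda+5}{2(\lambda+5)+\lambda^2L^2},\tfrac{\lambda+5}{\sigma\lambda^2L^2},\tfrac{\sigma\lambda^2L^2}{64r_2(\lambda+5)}\Big\}.$$ Then for every $k\ge0$ the set $\arg\max_{\bar p}\min_{\pi\in\Pi}\max_{p\in\mathcal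 P}\chi(\pi,p,\bar\pi_{k+1},\bar p)$ is nonempty and, for each choice of $\bar p(\bar\pi_{k+1})$ in it, with $\Phi_k=\Phi(\pi_k,p_k,\bar\pi_k,\bar p_k)$, $$\begin{aligned}\Phi_k-\Phi_{k+1}\ \ge\ &\tfrac{r_1}{32}\|\pi_{k+1}-\pi_k\|^2+\tfrac{r_2}{15}\|p_k-p_k^+(\bar\pi_k,\bar p_k)\|^2+\tfrac{r_1}{5\beta}\|\bar\pi_k-\bar\pi_{k+1}\|^2+\tfrac{r_2}{4\mu}\|\bar p_k^+(\bar\pi_{k+1})-\bar p_k\|^2\\&-4r_1\beta\,\big\|\pi(\bar\pi_{k+1},\bar p(\bar\pi_{k+1}))-\pi(\bar\pi_{k+1},\bar p_k^+(\bar\pi_{k+1}))\big\|^2 .\end{aligned}$$ -/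

import Mathlib

noncomputable section

/-- A minimizer of `f` over `K` (some minimizer if there are several). -/
def argminOn {E : Type*} [Nonempty E] (f : E → ℝ) (K : Set E) : E :=
  Classical.epsilon fun x => x ∈ K ∧ IsMinOn f K x

/-- A maximizer of `f` over `K` (some maximizer if there are several). -/
def argmaxOn {E : Type*} [Nonempty E] (f : E → ℝ) (K : Set E) : E :=
  Classical.epsilon fun x => x ∈ K ∧ IsMaxOn f K x

/-- The minimum of `f` over `K`. -/
def minVal {E : Type*} (f : E → ℝ) (K : Set E) : ℝ := sInf (f '' K)

/-- The maximum of `f` over `K`. -/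
def maxVal {E : Type*} (f : E → ℝ) (K : Set E) : ℝ := sSup (f '' K)

/-- The Euclidean projection of `x` onto `K`. -/
def euclProj {E : Type*} [NormedAddCommGroup E] (K : Set E) (x : E) : E :=
  argminOn (fun y => ‖y - x‖) K

/-- The space `ℝ^(S × A)` of policies, with the Frobenius norm. -/
abbrev PolSpace (S A : Type*) : Type _ := EuclideanSpace ℝ (S × A)

/-- The space `ℝ^(S × A × S)` of transition kernels, with the Frobenius norm. -/
abbrev KerSpace (S A : Type*) : Type _ := EuclideanSpace ℝ (S × A × S)

/-- A robust Markov decision process with finite state set `S` and action set `A`, costs in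
`[0, 1]`, and an `s`-rectangular ambiguity set with closed convex nonempty factors `amb s`. -/
structure RMDP (S A : Type*) [Fintype S] [Fintype A] where
  cost : S → A → S → ℝ
  cost_mem : ∀ s a s', cost s a s' ∈ Set.Icc (0 : ℝ) 1
  γ : ℝ
  γ_pos : 0 < γ
  γ_lt_one : γ < 1
  ρ : S → ℝ
  ρ_mem : ρ ∈ stdSimplex ℝ S
  amb : S → Set (A → S → ℝ)
  amb_nonempty : ∀ s, (amb s).Nonempty
  amb_convex : ∀ s, Convex ℝ (amb s)
  amb_closed : ∀ s, IsClosed (amb s)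
  amb_simplex : ∀ s, ∀ q ∈ amb s, ∀ a, q a ∈ stdSimplex ℝ S

/-- The four variables carried by the algorithm: `π`, `p`, `π̄`, `p̄`. -/
structure SRPGState (S A : Type*) where
  pol : PolSpace S A
  ker : KerSpace S A
  polBar : PolSpace S A
  kerBar : KerSpace S A

namespace RMDP

variable {S A : Type*} [Fintype S] [DecidableEq S] [Fintype A]

/-- The policy set `Π = (Δ^A)^S`. -/
def Pi (_M : RMDP S A) : Set (PolSpace S A) :=
  {π | ∀ s, (fun a => π (s, a)) ∈ stdSimplex ℝ A}

/-- The ambiguity set `𝒫 = ∏ₛ 𝒫ₛ`. -/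
def P (M : RMDP S A) : Set (KerSpace S A) :=
  {p | ∀ s, (fun a s' => p (s, a, s')) ∈ M.amb s}

/-- One-step state transition matrix under `π` and `p`; its `t`-th power holds the `t`-step
transition probabilities. -/
def transMat (π : PolSpace S A) (p : KerSpace S A) : Matrix S S ℝ :=
  Matrix.of fun s s' => ∑ a, π (s, a) * p (s, a, s')

/-- Expected one-step cost in state `s` under `π` and `p`. -/
def stepCost (M : RMDP S A) (π : PolSpace S A) (p : KerSpace S A) (s : S) : ℝ :=
  ∑ a, ∑ s', π (s, a) * p (s, a, s') * M.cost s a s'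

/-- The value function: the expected discounted cost
`𝔼[∑ₜ γᵗ c(sₜ, aₜ, sₜ₊₁) | s₀ = s]`. The formula also makes sense for `π`, `p` close to, but
outside, the products of simplices, which is what the gradients below refer to. -/
def value (M : RMDP S A) (π : PolSpace S A) (p : KerSpace S A) (s : S) : ℝ :=
  ∑' t : ℕ, M.γ ^ t * ∑ s', (transMat π p ^ t) s s' * M.stepCost π p s'

/-- The objective `J_ρ(π, p)`. -/
def J (M : RMDP S A) (π : PolSpace S A) (p : KerSpace S A) : ℝ :=
  ∑ s, M.ρ s * M.value π p s

/-- `ℓπp` and `ℓpπ` are Lipschitz constants on `Π × 𝒫` of the partial gradients of `J_ρ`. -/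
def GradLipschitz (M : RMDP S A) (ℓπp ℓpπ : ℝ) : Prop :=
  ∀ π ∈ M.Pi, ∀ π' ∈ M.Pi, ∀ p ∈ M.P, ∀ p' ∈ M.P,
    ‖gradient (fun x => M.J x p) π - gradient (fun x => M.J x p') π'‖
        ≤ ℓπp * (‖π - π'‖ + ‖p - p'‖) ∧
    ‖gradient (fun y => M.J π y) p - gradient (fun y => M.J π' y) p'‖
        ≤ ℓpπ * (‖π - π'‖ + ‖p - p'‖)

/-- The regularized function `χ(π, p, π̄, p̄)`. -/
def chi (M : RMDP S A) (r₁ r₂ : ℝ) (π : PolSpace S A) (p : KerSpace S A)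
    (πb : PolSpace S A) (pb : KerSpace S A) : ℝ :=
  M.J π p + r₁ / 2 * ‖π - πb‖ ^ 2 - r₂ / 2 * ‖p - pb‖ ^ 2

/-- `∇_π χ(π, p, π̄, p̄)`. -/
def gradPol (M : RMDP S A) (r₁ r₂ : ℝ) (π : PolSpace S A) (p : KerSpace S A)
    (πb : PolSpace S A) (pb : KerSpace S A) : PolSpace S A :=
  gradient (fun x => M.chi r₁ r₂ x p πb pb) π

/-- `∇_p χ(π, p, π̄, p̄)`. -/
def gradKer (M : RMDP S A) (r₁ r₂ : ℝ) (π : PolSpace S A) (p : KerSpace S A)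
    (πb : PolSpace S A) (pb : KerSpace S A) : KerSpace S A :=
  gradient (fun y => M.chi r₁ r₂ π y πb pb) p

/-- One iteration of the single-loop robust policy gradient method. -/
def srpgStep (M : RMDP S A) (r₁ r₂ τ σ β μ : ℝ) (x : SRPGState S A) : SRPGState S A :=
  let π' := euclProj M.Pi (x.pol - τ • M.gradPol r₁ r₂ x.pol x.ker x.polBar x.kerBar)
  let p' := euclProj M.P (x.ker + σ • M.gradKer r₁ r₂ π' x.ker x.polBar x.kerBar)
  { pol := π'
    ker := p'
    polBar := x.polBar + β • (π' - x.polBar)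
    kerBar := x.kerBar + μ • (p' - x.kerBar) }

/-- The iterates of the method, started at `π₀ = π̄₀` and `p₀ = p̄₀`. -/
def srpg (M : RMDP S A) (r₁ r₂ τ σ β μ : ℝ) (π₀ : PolSpace S A) (p₀ : KerSpace S A) :
    ℕ → SRPGState S A
  | 0 => { pol := π₀, ker := p₀, polBar := π₀, kerBar := p₀ }
  | k + 1 => M.srpgStep r₁ r₂ τ σ β μ (M.srpg r₁ r₂ τ σ β μ π₀ p₀ k)

/-- `φ_π(p, π̄, p̄) = min_{π ∈ Π} χ(π, p, π̄, p̄)`. -/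
def phiPol (M : RMDP S A) (r₁ r₂ : ℝ) (p : KerSpace S A)
    (πb : PolSpace S A) (pb : KerSpace S A) : ℝ :=
  minVal (fun π => M.chi r₁ r₂ π p πb pb) M.Pi

/-- `φ_p(π, π̄, p̄) = max_{p ∈ 𝒫} χ(π, p, π̄, p̄)`. -/
def phiKer (M : RMDP S A) (r₁ r₂ : ℝ) (π : PolSpace S A)
    (πb : PolSpace S A) (pb : KerSpace S A) : ℝ :=
  maxVal (fun p => M.chi r₁ r₂ π p πb pb) M.P

/-- `φ_{π,p}(π̄, p̄) = max_{p ∈ 𝒫} φ_π(p, π̄, p̄)`. -/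
def phiPolKer (M : RMDP S A) (r₁ r₂ : ℝ) (πb : PolSpace S A) (pb : KerSpace S A) : ℝ :=
  maxVal (fun p => M.phiPol r₁ r₂ p πb pb) M.P

/-- `φ_{π,p,p̄}(π̄) = max_{p̄} φ_{π,p}(π̄, p̄)`, over the whole space. -/
def phiPolKerBar (M : RMDP S A) (r₁ r₂ : ℝ) (πb : PolSpace S A) : ℝ :=
  maxVal (fun pb => M.phiPolKer r₁ r₂ πb pb) Set.univ

/-- `χ̲ = min_{π̄} max_{p̄} φ_{π,p}(π̄, p̄)`, over the whole spaces. -/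
def chiLow (M : RMDP S A) (r₁ r₂ : ℝ) : ℝ :=
  minVal (fun πb => M.phiPolKerBar r₁ r₂ πb) Set.univ

/-- The Lyapunov function `Φ(π, p, π̄, p̄)`. -/
def lyapunov (M : RMDP S A) (r₁ r₂ : ℝ) (x : SRPGState S A) : ℝ :=
  (M.chi r₁ r₂ x.pol x.ker x.polBar x.kerBar - M.phiPol r₁ r₂ x.ker x.polBar x.kerBar)
  + (M.phiPolKer r₁ r₂ x.polBar x.kerBar - M.phiPol r₁ r₂ x.ker x.polBar x.kerBar)
  + (M.phiPolKerBar r₁ r₂ x.polBar - M.phiPolKer r₁ r₂ x.polBar x.kerBar)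
  + (M.phiPolKerBar r₁ r₂ x.polBar - M.chiLow r₁ r₂)
  + M.chiLow r₁ r₂

/-- `π(p, π̄, p̄) = argmin_{π ∈ Π} χ(π, p, π̄, p̄)`. -/
def polOf (M : RMDP S A) (r₁ r₂ : ℝ) (p : KerSpace S A)
    (πb : PolSpace S A) (pb : KerSpace S A) : PolSpace S A :=
  argminOn (fun π => M.chi r₁ r₂ π p πb pb) M.Pi

/-- `p(π, π̄, p̄) = argmax_{p ∈ 𝒫} χ(π, p, π̄, p̄)`. -/
def kerOf (M : RMDP S A) (r₁ r₂ : ℝ) (π : PolSpace S A)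
    (πb : PolSpace S A) (pb : KerSpace S A) : KerSpace S A :=
  argmaxOn (fun p => M.chi r₁ r₂ π p πb pb) M.P

/-- `π(π̄, p̄) = argmin_{π ∈ Π} max_{p ∈ 𝒫} χ(π, p, π̄, p̄)`. -/
def polSaddle (M : RMDP S A) (r₁ r₂ : ℝ) (πb : PolSpace S A) (pb : KerSpace S A) :
    PolSpace S A :=
  argminOn (fun π => M.phiKer r₁ r₂ π πb pb) M.Pi

/-- The set `argmax_{p̄} min_{π ∈ Π} max_{p ∈ 𝒫} χ(π, p, π̄, p̄)`, with `p̄` ranging over the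
whole space; `p̄(π̄)` denotes any of its elements. -/
def kerBarArgmax (M : RMDP S A) (r₁ r₂ : ℝ) (πb : PolSpace S A) : Set (KerSpace S A) :=
  {q | IsMaxOn (fun pb => minVal (fun π => M.phiKer r₁ r₂ π πb pb) M.Pi) Set.univ q}

/-- `p⁺(π̄, p̄) = proj_𝒫 (p + σ ∇_p χ(π(p, π̄, p̄), p, π̄, p̄))`. -/
def kerPlus (M : RMDP S A) (r₁ r₂ σ : ℝ) (p : KerSpace S A)
    (πb : PolSpace S A) (pb : KerSpace S A) : KerSpace S A :=
  euclProj M.P (p + σ • M.gradKer r₁ r₂ (M.polOf r₁ r₂ p πb pb) p πb pb)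

/-- `p̄⁺(π̄) = p̄ + μ (p(π(π̄, p̄), π̄, p̄) - p̄)`. -/
def kerBarPlus (M : RMDP S A) (r₁ r₂ μ : ℝ) (pb : KerSpace S A) (πb : PolSpace S A) :
    KerSpace S A :=
  pb + μ • (M.kerOf r₁ r₂ (M.polSaddle r₁ r₂ πb pb) πb pb - pb)

end RMDP

/-- The admissible parameters, where `ℓπp = L` and `ℓpπ = lam * L`, with
`κ₆ = (2 τ r₁ + 1) / (τ (r₁ - L))`, `κ₁ = (ℓpπ + r₁ - ℓπp) / (r₁ - ℓπp)` and
`Lφ = ℓpπ κ₁ + ℓpπ + r₂`. -/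
structure SRPGAdmissible (L lam r₁ r₂ τ σ β μ : ℝ) : Prop where
  r₁_ge : 2 * L ≤ r₁
  r₂_ge : 2 * lam * L ≤ r₂
  τ_pos : 0 < τ
  τ_le : τ ≤ min (4 / (3 * (L + r₁))) (1 / (6 * lam * L))
  σ_pos : 0 < σ
  σ_le₁ : σ ≤ 2 / (3 * lam * L * ((2 * τ * r₁ + 1) / (τ * (r₁ - L))) ^ 2)
  σ_le₂ : σ ≤ 1 / (6 * (lam * L * ((lam * L + r₁ - L) / (r₁ - L)) + lam * L + r₂))
  σ_le₃ : σ ≤ 1 / (5 * lam * √(lam + 5) * L)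
  β_pos : 0 < β
  β_le₁ : β ≤ 24 * r₁ / (360 * r₁ + 5 * r₁ ^ 2 * lam + (2 * lam * L + 5 * r₁) ^ 2)
  β_le₂ : β ≤ σ * lam ^ 2 * L ^ 2 / (384 * r₁ * (lam + 5) * (lam + 1) ^ 2)
  μ_pos : 0 < μ
  μ_le₁ : μ ≤ (lam + 5) / (2 * (lam + 5) + lam ^ 2 * L ^ 2)
  μ_le₂ : μ ≤ (lam + 5) / (σ * lam ^ 2 * L ^ 2)
  μ_le₃ : μ ≤ σ * lam ^ 2 * L ^ 2 / (64 * r₂ * (lam + 5))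

end

/-! The only property of the decision process that matters is smoothness. Near the compact convex
set `Pi × P` the objective is C², being built from a convergent Neumann series, so its gradients are
Lipschitz there. As r₁ ≥ 2L and r₂ ≥ 2λL, the quadratic terms make χ strongly convex in π and
strongly concave in p. For fixed centres χ then has a unique saddle point, which depends on the
centres in a Lipschitz way. `SmoothOnProd.descent` proves the decrease for any function of this
kind.

In Φ the terms φ_{π,p} and χ̲ cancel, leaving Φ = χ - 2φ_π + 2φ_{π,p,p̄}. The projected step in π
and the move of π̄ lower χ. The step in p raises χ by a pairing ⟨∇_pχ, Δp⟩ but raises 2φ_π by twice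
that pairing up to errors, so one copy, at least ‖Δp‖²/σ, remains. The move of p̄ is paid for in the
same way.

Moving π̄ also leaves the pairing 2r₁⟨Δπ̄, x₄ - xs'⟩ between a saddle policy and a best response. It
is split along a chain of saddle points. `saddle_stability` and the error bounds for projected steps
control every link except one: the change of dual centre from p̄⁺ to the optimal p̄(π̄). That link
is the negative term of the conclusion. For small β and μ the main terms absorb the rest
(`descent_scalar`). -/

open scoped RealInnerProductSpace

/-! ### Regularized saddle problems: growth, existence and stability of saddle points. -/

section SaddlePoints

variable {E F : Type*} [NormedAddCommGroup E] [InnerProductSpace ℝ E]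
  [NormedAddCommGroup F] [InnerProductSpace ℝ F]

/-- A continuous function on a product of two nonempty compact convex sets, with partial gradients
that are Lipschitz continuous and that control the function up to quadratic terms. -/
structure SmoothOnProd (X : Set E) (Y : Set F) (f : E → F → ℝ) (gx : E → F → E) (gy : E → F → F)
    (L M : ℝ) : Prop where
  convex_left : Convex ℝ X
  convex_right : Convex ℝ Y
  compact_left : IsCompact X
  compact_right : IsCompact Y
  nonempty_left : X.Nonempty
  nonempty_right : Y.Nonempty
  continuousOn : ContinuousOn (fun w : E × F => f w.1 w.2) (X ×ˢ Y)
  abs_left : ∀ x ∈ X, ∀ x' ∈ X, ∀ y ∈ Y,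
    |f x' y - f x y - ⟪gx x y, x' - x⟫| ≤ L / 2 * ‖x' - x‖ ^ 2
  abs_right : ∀ x ∈ X, ∀ y ∈ Y, ∀ y' ∈ Y,
    |f x y' - f x y - ⟪gy x y, y' - y⟫| ≤ M / 2 * ‖y' - y‖ ^ 2
  lip_left : ∀ x ∈ X, ∀ x' ∈ X, ∀ y ∈ Y, ∀ y' ∈ Y,
    ‖gx x y - gx x' y'‖ ≤ L * (‖x - x'‖ + ‖y - y'‖)
  lip_right : ∀ x ∈ X, ∀ x' ∈ X, ∀ y ∈ Y, ∀ y' ∈ Y,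
    ‖gy x y - gy x' y'‖ ≤ M * (‖x - x'‖ + ‖y - y'‖)

/-- The doubly regularized function `f x y + r₁/2 ‖x - z‖² - r₂/2 ‖y - v‖²`. -/
noncomputable def regularize (f : E → F → ℝ) (r₁ r₂ : ℝ) (x : E) (y : F) (z : E) (v : F) : ℝ :=
  f x y + r₁ / 2 * ‖x - z‖ ^ 2 - r₂ / 2 * ‖y - v‖ ^ 2

/-- First-order optimality of `x` for minimizing the regularized function over `X`, at `y`. -/
def LeftOpt (X : Set E) (gx : E → F → E) (r₁ : ℝ) (x : E) (y : F) (z : E) : Prop :=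
  x ∈ X ∧ ∀ x' ∈ X, 0 ≤ ⟪gx x y + r₁ • (x - z), x' - x⟫

/-- First-order optimality of `y` for maximizing the regularized function over `Y`, at `x`. -/
def RightOpt (Y : Set F) (gy : E → F → F) (r₂ : ℝ) (x : E) (y : F) (v : F) : Prop :=
  y ∈ Y ∧ ∀ y' ∈ Y, ⟪gy x y - r₂ • (y - v), y' - y⟫ ≤ 0

lemma norm_sub_sq_expand (x x' z : E) :
    ‖x' - z‖ ^ 2 = ‖x - z‖ ^ 2 + 2 * ⟪x - z, x' - x⟫ + ‖x' - x‖ ^ 2 := by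
  have h : x' - z = (x - z) + (x' - x) := by abel
  rw [h, norm_add_sq_real]


/-- Divide by `t` and let `t → 0⁺`. This turns minimality along a segment into a first-order
condition. -/
lemma nonneg_of_forall_small {a c : ℝ} (h : ∀ t : ℝ, 0 < t → t ≤ 1 → 0 ≤ t * a + t ^ 2 * c) :
    0 ≤ a := by
  have hlim : Filter.Tendsto (fun t : ℝ => a + t * c) (nhdsWithin 0 (Set.Ioi 0)) (nhds a) := by
    have : Continuous fun t : ℝ => a + t * c := by fun_prop
    simpa using (this.tendsto 0).mono_left nhdsWithin_le_nhds
  refine ge_of_tendsto hlim ?_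
  filter_upwards [Ioc_mem_nhdsGT (show (0 : ℝ) < 1 by norm_num)] with t ht
  have h1 := h t ht.1 ht.2
  have h2 : 0 ≤ t * (a + t * c) := by nlinarith
  exact nonneg_of_mul_nonneg_right h2 ht.1

/-- A point of a convex set where a function with a quadratic upper model is minimal satisfies the
variational inequality. -/
lemma inner_nonneg_of_isMinOn {X : Set E} (hX : Convex ℝ X) {φ : E → ℝ} {x g : E} {c : ℝ}
    (hx : x ∈ X) (hmin : IsMinOn φ X x)
    (hup : ∀ x' ∈ X, φ x' ≤ φ x + ⟪g, x' - x⟫ + c * ‖x' - x‖ ^ 2) :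
    ∀ x' ∈ X, 0 ≤ ⟪g, x' - x⟫ := by
  intro x' hx'
  refine nonneg_of_forall_small (c := c * ‖x' - x‖ ^ 2) fun t ht ht1 => ?_
  have hmem : x + t • (x' - x) ∈ X := hX.add_smul_sub_mem hx hx' ⟨ht.le, ht1⟩
  have h1 := hup _ hmem
  have h2 : φ x ≤ φ (x + t • (x' - x)) := hmin hmem
  rw [add_sub_cancel_left, inner_smul_right, norm_smul, Real.norm_of_nonneg ht.le] at h1
  nlinarith

namespace SmoothOnProd

variable {X : Set E} {Y : Set F} {f : E → F → ℝ} {gx : E → F → E} {gy : E → F → F} {L M r₁ r₂ : ℝ}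

lemma regularize_left_lower (h : SmoothOnProd X Y f gx gy L M) {x x' z : E} {y v : F}
    (hx : x ∈ X) (hx' : x' ∈ X) (hy : y ∈ Y) :
    regularize f r₁ r₂ x y z v + ⟪gx x y + r₁ • (x - z), x' - x⟫ + (r₁ - L) / 2 * ‖x' - x‖ ^ 2
      ≤ regularize f r₁ r₂ x' y z v := by
  have h1 := (abs_le.mp (h.abs_left x hx x' hx' y hy)).1
  simp only [regularize, inner_add_left, real_inner_smul_left]
  rw [norm_sub_sq_expand x x' z]
  linarith

lemma regularize_left_upper (h : SmoothOnProd X Y f gx gy L M) {x x' z : E} {y v : F}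
    (hx : x ∈ X) (hx' : x' ∈ X) (hy : y ∈ Y) :
    regularize f r₁ r₂ x' y z v ≤
      regularize f r₁ r₂ x y z v + ⟪gx x y + r₁ • (x - z), x' - x⟫
        + (r₁ + L) / 2 * ‖x' - x‖ ^ 2 := by
  have h1 := (abs_le.mp (h.abs_left x hx x' hx' y hy)).2
  simp only [regularize, inner_add_left, real_inner_smul_left]
  rw [norm_sub_sq_expand x x' z]
  linarith

lemma regularize_right_upper (h : SmoothOnProd X Y f gx gy L M) {x z : E} {y y' v : F}
    (hx : x ∈ X) (hy : y ∈ Y) (hy' : y' ∈ Y) :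
    regularize f r₁ r₂ x y' z v ≤
      regularize f r₁ r₂ x y z v + ⟪gy x y - r₂ • (y - v), y' - y⟫
        - (r₂ - M) / 2 * ‖y' - y‖ ^ 2 := by
  have h1 := (abs_le.mp (h.abs_right x hx y hy y' hy')).2
  simp only [regularize, inner_sub_left _ (r₂ • (y - v)), real_inner_smul_left]
  rw [norm_sub_sq_expand y y' v]
  linarith

lemma regularize_right_lower (h : SmoothOnProd X Y f gx gy L M) {x z : E} {y y' v : F}
    (hx : x ∈ X) (hy : y ∈ Y) (hy' : y' ∈ Y) :
    regularize f r₁ r₂ x y z v + ⟪gy x y - r₂ • (y - v), y' - y⟫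
        - (r₂ + M) / 2 * ‖y' - y‖ ^ 2 ≤ regularize f r₁ r₂ x y' z v := by
  have h1 := (abs_le.mp (h.abs_right x hx y hy y' hy')).1
  simp only [regularize, inner_sub_left _ (r₂ • (y - v)), real_inner_smul_left]
  rw [norm_sub_sq_expand y y' v]
  linarith

lemma continuousOn_left (h : SmoothOnProd X Y f gx gy L M) {y v : F} {z : E} (hy : y ∈ Y) :
    ContinuousOn (fun x => regularize f r₁ r₂ x y z v) X := by
  have h1 : ContinuousOn (fun x => f x y) X :=
    h.continuousOn.comp (f := fun x => (x, y)) (by fun_prop) fun x hx => ⟨hx, hy⟩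
  unfold regularize
  fun_prop

lemma continuousOn_right (h : SmoothOnProd X Y f gx gy L M) {x z : E} {v : F} (hx : x ∈ X) :
    ContinuousOn (fun y => regularize f r₁ r₂ x y z v) Y := by
  have h1 : ContinuousOn (fun y => f x y) Y :=
    h.continuousOn.comp (f := fun y => (x, y)) (by fun_prop) fun y hy => ⟨hx, hy⟩
  unfold regularize
  fun_prop

lemma leftOpt_of_isMinOn (h : SmoothOnProd X Y f gx gy L M) {x z : E} {y v : F} (hx : x ∈ X)
    (hy : y ∈ Y) (hmin : IsMinOn (fun x => regularize f r₁ r₂ x y z v) X x) :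
    LeftOpt X gx r₁ x y z :=
  ⟨hx, inner_nonneg_of_isMinOn h.convex_left hx hmin fun _ hx' =>
    h.regularize_left_upper hx hx' hy⟩

lemma rightOpt_of_isMaxOn (h : SmoothOnProd X Y f gx gy L M) {x z : E} {y v : F} (hx : x ∈ X)
    (hy : y ∈ Y) (hmax : IsMaxOn (fun y => regularize f r₁ r₂ x y z v) Y y) :
    RightOpt Y gy r₂ x y v := by
  refine ⟨hy, fun y' hy' => ?_⟩
  have := inner_nonneg_of_isMinOn (g := -(gy x y - r₂ • (y - v))) (c := (r₂ + M) / 2)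
    h.convex_right hy (hmax.neg) (fun y' hy' => by
      have := h.regularize_right_lower (r₁ := r₁) (r₂ := r₂) (z := z) (v := v) hx hy hy'
      rw [inner_neg_left]
      linarith) y' hy'
  rw [inner_neg_left] at this
  linarith

lemma exists_isMinOn_left (h : SmoothOnProd X Y f gx gy L M) (r₁ r₂ : ℝ) (z : E) {y : F} (v : F)
    (hy : y ∈ Y) : ∃ x ∈ X, IsMinOn (fun x => regularize f r₁ r₂ x y z v) X x :=
  h.compact_left.exists_isMinOn h.nonempty_left (h.continuousOn_left hy)

lemma exists_isMaxOn_right (h : SmoothOnProd X Y f gx gy L M) (r₁ r₂ : ℝ) {x : E} (z : E) (v : F)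
    (hx : x ∈ X) : ∃ y ∈ Y, IsMaxOn (fun y => regularize f r₁ r₂ x y z v) Y y :=
  h.compact_right.exists_isMaxOn h.nonempty_right (h.continuousOn_right hx)

/-- The regularization leaves a convexity modulus r₁ - L, and the first-order term is nonnegative at
`x`. With `growth_right`, this gives the uniqueness and value comparisons used later. -/
lemma growth_left (h : SmoothOnProd X Y f gx gy L M) {x x' z : E} {y v : F} (hy : y ∈ Y)
    (hopt : LeftOpt X gx r₁ x y z) (hx' : x' ∈ X) :
    regularize f r₁ r₂ x y z v + (r₁ - L) / 2 * ‖x' - x‖ ^ 2 ≤ regularize f r₁ r₂ x' y z v := by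
  have h1 := h.regularize_left_lower (r₁ := r₁) (r₂ := r₂) (z := z) (v := v) hopt.1 hx' hy
  have h2 := hopt.2 x' hx'
  linarith

lemma growth_right (h : SmoothOnProd X Y f gx gy L M) {x z : E} {y y' v : F} (hx : x ∈ X)
    (hopt : RightOpt Y gy r₂ x y v) (hy' : y' ∈ Y) :
    regularize f r₁ r₂ x y' z v ≤ regularize f r₁ r₂ x y z v - (r₂ - M) / 2 * ‖y' - y‖ ^ 2 := by
  have h1 := h.regularize_right_upper (r₁ := r₁) (r₂ := r₂) (z := z) (v := v) hx hopt.1 hy'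
  have h2 := hopt.2 y' hy'
  linarith

/-- Weak monotonicity of the saddle operator of `f`. -/
lemma weak_monotone (h : SmoothOnProd X Y f gx gy L M) {x x' : E} {y y' : F}
    (hx : x ∈ X) (hx' : x' ∈ X) (hy : y ∈ Y) (hy' : y' ∈ Y) :
    -(L * ‖x - x'‖ ^ 2) - M * ‖y - y'‖ ^ 2 ≤
      ⟪gx x y - gx x' y', x - x'⟫ - ⟪gy x y - gy x' y', y - y'⟫ := by
  -- The four models go around the corners of the rectangle spanned by `x, x'` and `y, y'`, so all
  -- values of `f` cancel.
  have h1 := (abs_le.mp (h.abs_left x hx x' hx' y hy)).1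
  have h2 := (abs_le.mp (h.abs_left x' hx' x hx y' hy')).1
  have h3 := (abs_le.mp (h.abs_right x hx y hy y' hy')).2
  have h4 := (abs_le.mp (h.abs_right x' hx' y' hy' y hy)).2
  have e1 : x' - x = -(x - x') := by abel
  have e2 : y' - y = -(y - y') := by abel
  rw [e1, inner_neg_right, norm_neg] at h1
  rw [e2, inner_neg_right, norm_neg] at h3
  rw [inner_sub_left, inner_sub_left]
  linarith

lemma weak_monotone_left (h : SmoothOnProd X Y f gx gy L M) {x x' : E} {y : F}
    (hx : x ∈ X) (hx' : x' ∈ X) (hy : y ∈ Y) :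
    -(L * ‖x - x'‖ ^ 2) ≤ ⟪gx x y - gx x' y, x - x'⟫ := by
  have h1 := h.weak_monotone hx hx' hy hy
  simp only [sub_self, norm_zero, inner_zero_right] at h1
  linarith

/-- The two variational inequalities and weak monotonicity give (r₁ - L)‖x - x'‖² ≤ L‖y - y'‖‖x -
x'‖, and r₁ ≥ 2L makes the best response 1-Lipschitz. -/
lemma norm_leftOpt_sub_le (h : SmoothOnProd X Y f gx gy L M) (hL : 0 < L) (hr₁ : 2 * L ≤ r₁)
    {x x' z : E} {y y' : F} (hy : y ∈ Y) (hy' : y' ∈ Y)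
    (hx : LeftOpt X gx r₁ x y z) (hx' : LeftOpt X gx r₁ x' y' z) : ‖x - x'‖ ≤ ‖y - y'‖ := by
  have h1 := hx.2 x' hx'.1
  have h2 := hx'.2 x hx.1
  have h3 := h.weak_monotone_left hx.1 hx'.1 hy
  have h4 : ⟪gx x' y' - gx x' y, x - x'⟫ ≤ L * ‖y - y'‖ * ‖x - x'‖ := by
    refine (real_inner_le_norm _ _).trans (mul_le_mul_of_nonneg_right ?_ (norm_nonneg _))
    have := h.lip_left x' hx'.1 x' hx'.1 y' hy' y hy
    rwa [sub_self, norm_zero, zero_add, norm_sub_rev y' y] at this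
  have e1 : x' - x = -(x - x') := by abel
  have e2 : x - z = (x - x') + (x' - z) := by abel
  rw [e1, inner_neg_right, inner_add_left, real_inner_smul_left, e2, inner_add_left,
    real_inner_self_eq_norm_sq] at h1
  rw [inner_add_left, real_inner_smul_left] at h2
  rw [inner_sub_left] at h3 h4
  have h5 : L * ‖x - x'‖ ^ 2 ≤ L * (‖y - y'‖ * ‖x - x'‖) := by
    have : 0 ≤ (r₁ - 2 * L) * ‖x - x'‖ ^ 2 := mul_nonneg (by linarith) (sq_nonneg _)
    linarith
  have h6 := le_of_mul_le_mul_left h5 hL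
  by_contra! hlt
  have : 0 < ‖x - x'‖ := (norm_nonneg _).trans_lt hlt
  nlinarith

/-- A choice of minimizer over `X` depends continuously on `y`, hence so does the minimal value. -/
lemma continuousOn_value (h : SmoothOnProd X Y f gx gy L M) (hL : 0 < L) (hr₁ : 2 * L ≤ r₁)
    {z : E} {v : F} {m : F → E} (hm : ∀ y ∈ Y, LeftOpt X gx r₁ (m y) y z) :
    ContinuousOn (fun y => regularize f r₁ r₂ (m y) y z v) Y := by
  have hmc : ContinuousOn m Y := by
    have : LipschitzOnWith 1 m Y := LipschitzOnWith.of_dist_le_mul fun y hy y' hy' => by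
      simpa [dist_eq_norm] using h.norm_leftOpt_sub_le hL hr₁ hy hy' (hm y hy) (hm y' hy')
    exact this.continuousOn
  have h1 : ContinuousOn (fun y => f (m y) y) Y :=
    h.continuousOn.comp (f := fun y => (m y, y)) (hmc.prodMk continuousOn_id)
      fun y hy => ⟨(hm y hy).1, hy⟩
  exact (h1.add (((hmc.sub continuousOn_const).norm.pow 2).const_mul _)).sub (by fun_prop)

/-- Existence of a saddle point, located at any maximizer of the minimal value. -/
lemma rightOpt_of_isMaxOn_value (h : SmoothOnProd X Y f gx gy L M) (hL : 0 < L)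
    (hr₁ : 2 * L ≤ r₁) (hr₂ : M ≤ r₂)
    {z : E} {v : F} {m : F → E} (hm : ∀ y ∈ Y, LeftOpt X gx r₁ (m y) y z) {y : F} (hy : y ∈ Y)
    (hmax : IsMaxOn (fun y => regularize f r₁ r₂ (m y) y z v) Y y) :
    RightOpt Y gy r₂ (m y) y v := by
  refine h.rightOpt_of_isMaxOn (r₁ := r₁) (z := z) (hm y hy).1 hy fun y' hy' => ?_
  have hseg : ∀ t : ℝ, 0 < t → t ≤ 1 → y + t • (y' - y) ∈ Y := fun t ht ht1 =>
    h.convex_right.add_smul_sub_mem hy hy' ⟨ht.le, ht1⟩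
  -- Write d for the minimal value. Since d w ≤ d y, concavity in the second variable at `m w`
  -- forces the slope `i` at `w` towards `y'` to be nonpositive. Hence the value at `(m w, y')` is
  -- at most d w ≤ d y. As `t → 0`, `m w` tends to `m y`, which gives the saddle inequality without
  -- a minimax theorem.
  have key : ∀ t : ℝ, 0 < t → t ≤ 1 →
      regularize f r₁ r₂ (m (y + t • (y' - y))) y' z v ≤ regularize f r₁ r₂ (m y) y z v := by
    intro t ht ht1
    have hyt := hseg t ht ht1
    set w := y + t • (y' - y) with hw
    have h1 : regularize f r₁ r₂ (m w) w z v ≤ regularize f r₁ r₂ (m y) y z v := hmax hyt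
    have h2 := h.growth_left (r₂ := r₂) (v := v) hy (hm y hy) (hm w hyt).1
    have h3 := h.regularize_right_upper (r₁ := r₁) (r₂ := r₂) (z := z) (v := v)
      (hm w hyt).1 hyt hy'
    have h4 := h.regularize_right_upper (r₁ := r₁) (r₂ := r₂) (z := z) (v := v)
      (hm w hyt).1 hyt hy
    have e1 : y' - w = (1 - t) • (y' - y) := by rw [hw]; module
    have e2 : y - w = -(t • (y' - y)) := by rw [hw]; module
    rw [e1, inner_smul_right] at h3
    rw [e2, inner_neg_right, inner_smul_right] at h4
    have h5 : 0 ≤ (r₂ - M) / 2 * ‖(1 - t) • (y' - y)‖ ^ 2 :=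
      mul_nonneg (by linarith) (sq_nonneg _)
    have h6 : 0 ≤ (r₂ - M) / 2 * ‖-(t • (y' - y))‖ ^ 2 := mul_nonneg (by linarith) (sq_nonneg _)
    have h7 : 0 ≤ (r₁ - L) / 2 * ‖m w - m y‖ ^ 2 := mul_nonneg (by linarith) (sq_nonneg _)
    set i := ⟪gy (m w) w - r₂ • (w - v), y' - y⟫
    have h8 : t * i ≤ 0 := by linarith
    have h9 : i ≤ 0 := by
      by_contra! hi
      have := mul_pos ht hi
      linarith
    have h10 : (1 - t) * i ≤ 0 := mul_nonpos_of_nonneg_of_nonpos (by linarith) h9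
    linarith
  have hdist : ∀ t : ℝ, 0 < t → t ≤ 1 → ‖m (y + t • (y' - y)) - m y‖ ≤ t * ‖y' - y‖ := by
    intro t ht ht1
    have := h.norm_leftOpt_sub_le hL hr₁ (hseg t ht ht1) hy (hm _ (hseg t ht ht1)) (hm y hy)
    rwa [add_sub_cancel_left, norm_smul, Real.norm_of_nonneg ht.le] at this
  have hmt : Filter.Tendsto (fun t : ℝ => m (y + t • (y' - y))) (nhdsWithin 0 (Set.Ioi 0))
      (nhdsWithin (m y) X) := by
    refine tendsto_nhdsWithin_iff.mpr ⟨?_, ?_⟩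
    · rw [tendsto_iff_norm_sub_tendsto_zero]
      have h0 : Filter.Tendsto (fun t : ℝ => t * ‖y' - y‖) (nhdsWithin 0 (Set.Ioi 0)) (nhds 0) := by
        have : Continuous fun t : ℝ => t * ‖y' - y‖ := by fun_prop
        simpa using (this.tendsto 0).mono_left nhdsWithin_le_nhds
      refine squeeze_zero' (Filter.Eventually.of_forall fun _ => norm_nonneg _) ?_ h0
      filter_upwards [Ioc_mem_nhdsGT (show (0 : ℝ) < 1 by norm_num)] with t ht
      exact hdist t ht.1 ht.2
    · filter_upwards [Ioc_mem_nhdsGT (show (0 : ℝ) < 1 by norm_num)] with t ht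
      exact (hm _ (hseg t ht.1 ht.2)).1
  have hlim := (h.continuousOn_left (r₁ := r₁) (r₂ := r₂) (z := z) (v := v) hy'
    (m y) (hm y hy).1).tendsto.comp hmt
  refine le_of_tendsto hlim ?_
  filter_upwards [Ioc_mem_nhdsGT (show (0 : ℝ) < 1 by norm_num)] with t ht
  exact key t ht.1 ht.2

lemma exists_saddle (h : SmoothOnProd X Y f gx gy L M) (hL : 0 < L)
    (hr₁ : 2 * L ≤ r₁) (hr₂ : M ≤ r₂) (z : E) (v : F) :
    ∃ x y, LeftOpt X gx r₁ x y z ∧ RightOpt Y gy r₂ x y v := by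
  have hex : ∀ y, ∃ x, y ∈ Y → LeftOpt X gx r₁ x y z := fun y => by
    by_cases hy : y ∈ Y
    · obtain ⟨x, hx, hmin⟩ := h.exists_isMinOn_left r₁ r₂ z v hy
      exact ⟨x, fun _ => h.leftOpt_of_isMinOn hx hy hmin⟩
    · exact ⟨z, fun hy' => absurd hy' hy⟩
  choose m hm using hex
  obtain ⟨y, hy, hmax⟩ := h.compact_right.exists_isMaxOn h.nonempty_right
    (h.continuousOn_value (r₂ := r₂) (v := v) hL hr₁ hm)
  exact ⟨m y, y, hm y hy, h.rightOpt_of_isMaxOn_value hL hr₁ hr₂ hm hy hmax⟩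

/-- Stability of saddle points under perturbation of the centres. -/
lemma saddle_stability (h : SmoothOnProd X Y f gx gy L M) {x x' z z' : E} {y y' v v' : F}
    (hx : LeftOpt X gx r₁ x y z) (hy : RightOpt Y gy r₂ x y v)
    (hx' : LeftOpt X gx r₁ x' y' z') (hy' : RightOpt Y gy r₂ x' y' v') :
    (r₁ - L) * ‖x - x'‖ ^ 2 + (r₂ - M) * ‖y - y'‖ ^ 2 ≤
      r₁ * ⟪z - z', x - x'⟫ + r₂ * ⟪v - v', y - y'⟫ := by
  -- The gradient pairings of the four variational inequalities add up to the saddle operator, which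
  -- `weak_monotone` bounds below.
  have h1 := hx.2 x' hx'.1
  have h2 := hx'.2 x hx.1
  have h3 := hy.2 y' hy'.1
  have h4 := hy'.2 y hy.1
  have h5 := h.weak_monotone hx.1 hx'.1 hy.1 hy'.1
  have e1 : x' - x = -(x - x') := by abel
  have e2 : x - z = (x - x') - (z - z') + (x' - z') := by abel
  have e3 : y' - y = -(y - y') := by abel
  have e4 : y - v = (y - y') - (v - v') + (y' - v') := by abel
  rw [e1, inner_neg_right, inner_add_left, real_inner_smul_left, e2, inner_add_left,
    inner_sub_left, real_inner_self_eq_norm_sq] at h1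
  rw [inner_add_left, real_inner_smul_left] at h2
  rw [e3, inner_neg_right, inner_sub_left, real_inner_smul_left, e4, inner_add_left,
    inner_sub_left, real_inner_self_eq_norm_sq] at h3
  rw [inner_sub_left, real_inner_smul_left] at h4
  rw [inner_sub_left, inner_sub_left] at h5
  linarith

end SmoothOnProd

/-! ### Projected gradient steps: error bounds and changes of value. -/

/-- The variational characterization of `p` as the Euclidean projection of `u` onto `K`. -/
def IsProj (K : Set E) (u p : E) : Prop := p ∈ K ∧ ∀ w ∈ K, ⟪u - p, w - p⟫ ≤ 0

lemma IsProj.norm_sub_le {K : Set E} {u u' p p' : E} (hp : IsProj K u p) (hp' : IsProj K u' p') :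
    ‖p - p'‖ ≤ ‖u - u'‖ := by
  have h1 := hp.2 p' hp'.1
  have h2 := hp'.2 p hp.1
  have e1 : p' - p = -(p - p') := by abel
  have e2 : u - p = (u - u') + (u' - p') - (p - p') := by abel
  rw [e1, inner_neg_right, e2, inner_sub_left, inner_add_left, real_inner_self_eq_norm_sq] at h1
  have h3 := real_inner_le_norm (u - u') (p - p')
  by_contra! hlt
  have : 0 < ‖p - p'‖ := (norm_nonneg _).trans_lt hlt
  nlinarith

/-- Cancels a possibly zero norm: the error bounds arise from inner products and so carry an extra
factor of the distance being estimated. -/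
lemma le_of_mul_sq_le {a b x : ℝ} (hx : 0 ≤ x) (hb : 0 ≤ b) (h : a * x ^ 2 ≤ b * x) :
    a * x ≤ b := by
  rcases hx.eq_or_lt with h0 | h0
  · rw [← h0, mul_zero]; exact hb
  · exact le_of_mul_le_mul_right (by linarith [sq x, mul_assoc a x x]) h0

namespace SmoothOnProd

variable {X : Set E} {Y : Set F} {f : E → F → ℝ} {gx : E → F → E} {gy : E → F → F} {L M r₁ r₂ : ℝ}

/-- Error bound for a projected gradient step in the minimization variable. -/
lemma norm_primal_step_sub_le (h : SmoothOnProd X Y f gx gy L M) {τ : ℝ} (hτ : 0 < τ)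
    (hL : 0 < L) (hr₁ : 0 ≤ r₁) {x xp xs z : E} {y : F} (hx : x ∈ X) (hy : y ∈ Y)
    (hxp : IsProj X (x - τ • (gx x y + r₁ • (x - z))) xp) (hxs : LeftOpt X gx r₁ xs y z) :
    τ * (r₁ - L) * ‖xp - xs‖ ≤ (1 + τ * (L + r₁)) * ‖xp - x‖ := by
  refine le_of_mul_sq_le (norm_nonneg _) (by positivity) ?_
  have h1 := hxp.2 xs hxs.1
  have h2 := hxs.2 xp hxp.1
  have h3 := h.weak_monotone_left hxp.1 hxs.1 hy
  have h4 : ⟪gx xp y - gx x y, xp - xs⟫ ≤ L * ‖xp - x‖ * ‖xp - xs‖ := by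
    refine (real_inner_le_norm _ _).trans (mul_le_mul_of_nonneg_right ?_ (norm_nonneg _))
    simpa using h.lip_left xp hxp.1 x hx y hy y hy
  have h5 : -⟪xp - x, xp - xs⟫ ≤ ‖xp - x‖ * ‖xp - xs‖ := by
    rw [← inner_neg_left, ← norm_neg (xp - x)]; exact real_inner_le_norm _ _
  have h6 : ⟪xp - x, xp - xs⟫ ≤ ‖xp - x‖ * ‖xp - xs‖ := real_inner_le_norm _ _
  have e1 : xs - xp = -(xp - xs) := by abel
  -- Splitting `x - z` this way isolates r₁‖xp - xs‖². Taking the gradient at `x` instead of `xp`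
  -- costs (L + r₁)‖xp - x‖.
  have e2 : x - τ • (gx x y + r₁ • (x - z)) - xp =
      -(xp - x) - τ • (gx x y + r₁ • ((xp - xs) - (xp - x) + (xs - z))) := by
    have : x - z = (xp - xs) - (xp - x) + (xs - z) := by abel
    rw [← this]; abel
  rw [e1, e2, inner_neg_right, inner_sub_left, inner_neg_left, real_inner_smul_left,
    inner_add_left, real_inner_smul_left, inner_add_left, inner_sub_left (xp - xs) (xp - x),
    real_inner_self_eq_norm_sq] at h1
  rw [inner_add_left, real_inner_smul_left] at h2
  rw [inner_sub_left] at h3 h4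
  have h7 := mul_le_mul_of_nonneg_left h4 hτ.le
  have h8 := mul_le_mul_of_nonneg_left h3 hτ.le
  have h9 := mul_le_mul_of_nonneg_left h2 hτ.le
  have h10 := mul_le_mul_of_nonneg_left h6 (mul_nonneg hτ.le hr₁)
  linarith

/-- Error bound for an inexact projected gradient step on the dual function. -/
lemma norm_dual_step_sub_le (h : SmoothOnProd X Y f gx gy L M) {α : ℝ} (hα : 0 < α)
    (hL : 0 < L) (hM : 0 < M) (hr₁ : 2 * L ≤ r₁) (hr₂ : 0 ≤ r₂) {xp xs x₀ z : E} {y yp y₀ v : F}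
    (hxp : xp ∈ X) (hy : y ∈ Y)
    (hyp : IsProj Y (y + α • (gy xp y - r₂ • (y - v))) yp) (hxs : LeftOpt X gx r₁ xs y z)
    (hx₀ : LeftOpt X gx r₁ x₀ y₀ z) (hy₀ : RightOpt Y gy r₂ x₀ y₀ v) :
    α * (r₂ - M) * ‖yp - y₀‖ ≤ α * M * ‖xp - xs‖ + (1 + α * (2 * M + r₂)) * ‖yp - y‖ := by
  refine le_of_mul_sq_le (norm_nonneg _) (by positivity) ?_
  -- `w` is the best response to `yp`. Saddle monotonicity applies to `gy w yp`, whereas the step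
  -- uses `gy xp y`. The exchange costs M‖xp - xs‖ plus 2M‖yp - y‖, one M for the change of `y` and
  -- one for the 1-Lipschitz best response.
  obtain ⟨w, hw, hwmin⟩ := h.exists_isMinOn_left r₁ r₂ z v hyp.1
  have hwo := h.leftOpt_of_isMinOn hw hyp.1 hwmin
  have h1 := hyp.2 y₀ hy₀.1
  have h2 := hy₀.2 yp hyp.1
  have h3 := h.weak_monotone hw hx₀.1 hyp.1 hy₀.1
  have h4 : ⟪gx w yp - gx x₀ y₀, w - x₀⟫ + r₁ * ‖w - x₀‖ ^ 2 ≤ 0 := by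
    have k1 := hwo.2 x₀ hx₀.1
    have k2 := hx₀.2 w hw
    have e1 : x₀ - w = -(w - x₀) := by abel
    have e2 : w - z = (w - x₀) + (x₀ - z) := by abel
    rw [e1, inner_neg_right, inner_add_left, real_inner_smul_left, e2, inner_add_left,
      real_inner_self_eq_norm_sq] at k1
    rw [inner_add_left, real_inner_smul_left] at k2
    rw [inner_sub_left]
    linarith
  have h5 : ⟪gy xp y - gy xs y, yp - y₀⟫ ≤ M * ‖xp - xs‖ * ‖yp - y₀‖ := by
    refine (real_inner_le_norm _ _).trans (mul_le_mul_of_nonneg_right ?_ (norm_nonneg _))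
    simpa using h.lip_right xp hxp xs hxs.1 y hy y hy
  have h6 : ⟪gy xs y - gy w yp, yp - y₀⟫ ≤ M * (2 * ‖yp - y‖) * ‖yp - y₀‖ := by
    refine (real_inner_le_norm _ _).trans (mul_le_mul_of_nonneg_right ?_ (norm_nonneg _))
    refine (h.lip_right xs hxs.1 w hw y hy yp hyp.1).trans
      (mul_le_mul_of_nonneg_left ?_ hM.le)
    have := h.norm_leftOpt_sub_le hL hr₁ hy hyp.1 hxs hwo
    rw [norm_sub_rev yp y]; linarith
  have h7 : -⟪yp - y, yp - y₀⟫ ≤ ‖yp - y‖ * ‖yp - y₀‖ := by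
    rw [← inner_neg_left, ← norm_neg (yp - y)]; exact real_inner_le_norm _ _
  have h8 : ⟪yp - y, yp - y₀⟫ ≤ ‖yp - y‖ * ‖yp - y₀‖ := real_inner_le_norm _ _
  have h9 : 0 ≤ (r₁ - L) * ‖w - x₀‖ ^ 2 := mul_nonneg (by linarith) (sq_nonneg _)
  have e1 : y₀ - yp = -(yp - y₀) := by abel
  have e2 : y + α • (gy xp y - r₂ • (y - v)) - yp =
      -(yp - y) + α • (gy xp y - r₂ • ((yp - y₀) - (yp - y) + (y₀ - v))) := by
    have : y - v = (yp - y₀) - (yp - y) + (y₀ - v) := by abel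
    rw [← this]; abel
  rw [e1, e2, inner_neg_right, inner_add_left, inner_neg_left, real_inner_smul_left,
    inner_sub_left (gy xp y), real_inner_smul_left, inner_add_left,
    inner_sub_left (yp - y₀) (yp - y),
    real_inner_self_eq_norm_sq] at h1
  rw [inner_sub_left, real_inner_smul_left] at h2
  rw [inner_sub_left (gy w yp)] at h3
  rw [inner_sub_left] at h5 h6
  have k : ⟪gy xp y, yp - y₀⟫ ≤ M * ‖xp - xs‖ * ‖yp - y₀‖ + M * (2 * ‖yp - y‖) * ‖yp - y₀‖
      + M * ‖yp - y₀‖ ^ 2 + r₂ * ⟪y₀ - v, yp - y₀⟫ := by linarith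
  have k1 := mul_le_mul_of_nonneg_left k hα.le
  have k2 := mul_le_mul_of_nonneg_left h8 (mul_nonneg hα.le hr₂)
  linarith

/-- Testing the projection at `x` bounds the first-order term by -‖xp - x‖²/τ, and the quadratic
upper model costs (r₁ + L)/2. -/
lemma regularize_primal_step (h : SmoothOnProd X Y f gx gy L M) {τ : ℝ} (hτ : 0 < τ)
    {x xp z : E} {y v : F} (hx : x ∈ X) (hy : y ∈ Y)
    (hxp : IsProj X (x - τ • (gx x y + r₁ • (x - z))) xp) :
    regularize f r₁ r₂ xp y z v + (1 / τ - (r₁ + L) / 2) * ‖xp - x‖ ^ 2 ≤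
      regularize f r₁ r₂ x y z v := by
  have h1 := h.regularize_left_upper (r₁ := r₁) (r₂ := r₂) (z := z) (v := v) hx hxp.1 hy
  have h2 := hxp.2 x hx
  have e1 : x - xp = -(xp - x) := by abel
  have e2 : x - τ • (gx x y + r₁ • (x - z)) - xp =
      -(xp - x) - τ • (gx x y + r₁ • (x - z)) := by abel
  rw [e1, e2, inner_neg_right, inner_sub_left, inner_neg_left, real_inner_self_eq_norm_sq,
    real_inner_smul_left] at h2
  have h3 : 1 / τ * ‖xp - x‖ ^ 2 + ⟪gx x y + r₁ • (x - z), xp - x⟫ ≤ 0 := by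
    have h3 : ‖xp - x‖ ^ 2 + τ * ⟪gx x y + r₁ • (x - z), xp - x⟫ ≤ 0 := by linarith
    have := mul_le_mul_of_nonneg_left h3 (one_div_pos.mpr hτ).le
    field_simp at this ⊢
    linarith
  linarith

lemma saddle_left_centre_le (h : SmoothOnProd X Y f gx gy L M) (hL : 0 < L) (hr₁ : 2 * L ≤ r₁)
    (hr₂ : M ≤ r₂) {x x' z z' : E} {y y' v : F}
    (hx : LeftOpt X gx r₁ x y z) (hy : RightOpt Y gy r₂ x y v)
    (hx' : LeftOpt X gx r₁ x' y' z') (hy' : RightOpt Y gy r₂ x' y' v) :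
    ‖x - x'‖ ≤ 2 * ‖z - z'‖ := by
  have h1 := h.saddle_stability hx hy hx' hy'
  rw [sub_self v, inner_zero_left, mul_zero, add_zero] at h1
  have h2 : 0 ≤ (r₂ - M) * ‖y - y'‖ ^ 2 := mul_nonneg (by linarith) (sq_nonneg _)
  have h3 : r₁ * ⟪z - z', x - x'⟫ ≤ r₁ * (‖z - z'‖ * ‖x - x'‖) :=
    mul_le_mul_of_nonneg_left (real_inner_le_norm _ _) (by linarith)
  have h4 : 0 ≤ (r₁ - 2 * L) * ‖x - x'‖ ^ 2 := mul_nonneg (by linarith) (sq_nonneg _)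
  have h5 := le_of_mul_sq_le (a := r₁ / 2) (b := r₁ * ‖z - z'‖) (norm_nonneg (x - x'))
    (mul_nonneg (by linarith) (norm_nonneg _)) (by linarith)
  have hr : 0 < r₁ := by linarith
  nlinarith

/-- Since r₁ - L ≥ r₁/2, Young's inequality absorbs the primal distance entirely and leaves control
of the dual one. -/
lemma saddle_right_centre_le (h : SmoothOnProd X Y f gx gy L M) (hL : 0 < L) (hr₁ : 2 * L ≤ r₁)
    (hr₂ : 2 * M ≤ r₂) {x x' z z' : E} {y y' v : F}
    (hx : LeftOpt X gx r₁ x y z) (hy : RightOpt Y gy r₂ x y v)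
    (hx' : LeftOpt X gx r₁ x' y' z') (hy' : RightOpt Y gy r₂ x' y' v) :
    r₂ * ‖y - y'‖ ^ 2 ≤ r₁ * ‖z - z'‖ ^ 2 := by
  have h1 := h.saddle_stability hx hy hx' hy'
  rw [sub_self v, inner_zero_left, mul_zero, add_zero] at h1
  have h2 : 0 ≤ (r₂ - 2 * M) * ‖y - y'‖ ^ 2 := mul_nonneg (by linarith) (sq_nonneg _)
  have h3 : r₁ * ⟪z - z', x - x'⟫ ≤ r₁ * (‖z - z'‖ * ‖x - x'‖) :=
    mul_le_mul_of_nonneg_left (real_inner_le_norm _ _) (by linarith)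
  have h4 : 0 ≤ (r₁ - 2 * L) * ‖x - x'‖ ^ 2 := mul_nonneg (by linarith) (sq_nonneg _)
  have h5 : 0 ≤ r₁ * (‖z - z'‖ - ‖x - x'‖) ^ 2 := mul_nonneg (by linarith) (sq_nonneg _)
  linarith

lemma saddle_left_dual_centre_le (h : SmoothOnProd X Y f gx gy L M) (hr₁ : 2 * L ≤ r₁)
    (hM : 0 < M) (hr₂ : 2 * M ≤ r₂) {x x' z : E} {y y' v v' : F}
    (hx : LeftOpt X gx r₁ x y z) (hy : RightOpt Y gy r₂ x y v)
    (hx' : LeftOpt X gx r₁ x' y' z) (hy' : RightOpt Y gy r₂ x' y' v') :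
    r₁ * ‖x - x'‖ ^ 2 ≤ r₂ * ‖v - v'‖ ^ 2 := by
  have h1 := h.saddle_stability hx hy hx' hy'
  rw [sub_self z, inner_zero_left, mul_zero, zero_add] at h1
  have h2 : 0 ≤ (r₂ - 2 * M) * ‖y - y'‖ ^ 2 := mul_nonneg (by linarith) (sq_nonneg _)
  have h3 : r₂ * ⟪v - v', y - y'⟫ ≤ r₂ * (‖v - v'‖ * ‖y - y'‖) :=
    mul_le_mul_of_nonneg_left (real_inner_le_norm _ _) (by linarith)
  have h4 : 0 ≤ (r₁ - 2 * L) * ‖x - x'‖ ^ 2 := mul_nonneg (by linarith) (sq_nonneg _)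
  have h5 : 0 ≤ r₂ * (‖v - v'‖ - ‖y - y'‖) ^ 2 := mul_nonneg (by linarith) (sq_nonneg _)
  linarith

/-- Change of the optimal regularized value under a move of the primal centre. -/
lemma saddle_value_sub_ge (h : SmoothOnProd X Y f gx gy L M) (hr₁ : L ≤ r₁) (hr₂ : M ≤ r₂)
    {x x' z z' : E} {y y' q : F}
    (hx : LeftOpt X gx r₁ x y z) (hy : RightOpt Y gy r₂ x y q)
    (hx' : LeftOpt X gx r₁ x' y' z') (hy' : RightOpt Y gy r₂ x' y' q) :
    r₁ * ⟪z' - z, x - z⟫ - r₁ / 2 * ‖z' - z‖ ^ 2 ≤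
      regularize f r₁ r₂ x y z q - regularize f r₁ r₂ x' y' z' q := by
  -- Both saddle values are compared at the mixed point `(x, y')`, where changing the centre alters
  -- only an explicit quadratic.
  have h1 := h.growth_left (r₂ := r₂) (v := q) hy'.1 hx' hx.1
  have h2 := h.growth_right (r₁ := r₁) (z := z) hx.1 hy hy'.1
  have h3 : 0 ≤ (r₁ - L) / 2 * ‖x - x'‖ ^ 2 := mul_nonneg (by linarith) (sq_nonneg _)
  have h4 : 0 ≤ (r₂ - M) / 2 * ‖y' - y‖ ^ 2 := mul_nonneg (by linarith) (sq_nonneg _)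
  have h5 : ‖x - z'‖ ^ 2 = ‖x - z‖ ^ 2 - 2 * ⟪z' - z, x - z⟫ + ‖z' - z‖ ^ 2 := by
    rw [show x - z' = (x - z) - (z' - z) by abel, norm_sub_sq_real, real_inner_comm]
  have h6 : regularize f r₁ r₂ x y' z q - regularize f r₁ r₂ x y' z' q =
      r₁ * ⟪z' - z, x - z⟫ - r₁ / 2 * ‖z' - z‖ ^ 2 := by
    unfold regularize
    rw [h5]; ring
  linarith

/-- Lower bound on the increase of the dual function `min_x` over one iteration. -/
lemma dual_value_sub_ge (h : SmoothOnProd X Y f gx gy L M) (hL : 0 < L) (hM : 0 < M)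
    (hr₁ : 2 * L ≤ r₁) {xp xs xs' z z' : E} {y yp v : F} (hxp : xp ∈ X) (hy : y ∈ Y)
    (hyp : yp ∈ Y) (hxs : LeftOpt X gx r₁ xs y z) (hxs' : LeftOpt X gx r₁ xs' yp z') :
    ⟪gy xp y - r₂ • (y - v), yp - y⟫ - M * (‖xp - xs‖ + ‖yp - y‖) * ‖yp - y‖
        - (r₂ + M) / 2 * ‖yp - y‖ ^ 2 ≤
      regularize f r₁ r₂ xs' yp z v - regularize f r₁ r₂ xs y z v := by
  -- `w` is the best response to `yp` at the old centre `z`, so it bounds the value at `xs'` from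
  -- below and lies within ‖yp - y‖ of `xs`.
  obtain ⟨w, hw, hwmin⟩ := h.exists_isMinOn_left r₁ r₂ z v hyp
  have hwo := h.leftOpt_of_isMinOn hw hyp hwmin
  have h1 : regularize f r₁ r₂ w yp z v ≤ regularize f r₁ r₂ xs' yp z v := hwmin hxs'.1
  have h2 := h.growth_left (r₂ := r₂) (v := v) hy hxs hw
  have h3 : 0 ≤ (r₁ - L) / 2 * ‖w - xs‖ ^ 2 := mul_nonneg (by linarith) (sq_nonneg _)
  have h4 := h.regularize_right_lower (r₁ := r₁) (r₂ := r₂) (z := z) (v := v) hw hy hyp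
  have h5 : ⟪gy xp y - gy w y, yp - y⟫ ≤ M * (‖xp - xs‖ + ‖yp - y‖) * ‖yp - y‖ := by
    refine (real_inner_le_norm _ _).trans (mul_le_mul_of_nonneg_right ?_ (norm_nonneg _))
    refine (h.lip_right xp hxp w hw y hy y hy).trans (mul_le_mul_of_nonneg_left ?_ hM.le)
    have k := h.norm_leftOpt_sub_le hL hr₁ hy hyp hxs hwo
    have k2 := norm_sub_le_norm_sub_add_norm_sub xp xs w
    rw [norm_sub_rev y yp] at k
    simp only [sub_self, norm_zero]
    linarith
  rw [inner_sub_left] at h5 h4 ⊢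
  linarith

end SmoothOnProd

/-! ### The descent estimate. -/

/-- The scalar inequality behind the descent estimate, in terms of the inverse step sizes
`T = 1/τ`, `Q = 1/α`, `B = 1/β`, `N = 1/μ`. -/
lemma descent_scalar {L M r₁ r₂ T Q B N α β μ K dx dy dz W V e e₁ e₂ s : ℝ}
    (hL : 0 < L) (hM : 0 < M) (hr₁ : 2 * L ≤ r₁) (hr₂ : 2 * M ≤ r₂)
    (hα : 0 < α) (hβ : 0 < β) (hQ : α * Q = 1) (hN : μ * N = 1)
    (hT : 3 * (L + r₁) ≤ 4 * T) (hT' : 6 * M ≤ T) (hQK : 3 * (M * K ^ 2) ≤ 2 * Q)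
    (hQM : 6 * (2 * M + r₂) ≤ Q) (hB : 100 ≤ B) (hβ' : β ≤ 1 / 100)
    (hβα : 1920 * (r₁ * β) ≤ α * M ^ 2) (hN2 : 2 ≤ N) (hμα : 320 * (r₂ * μ) ≤ α * M ^ 2)
    (hdy : 0 ≤ dy) (hs : 0 ≤ s) (he₁ : 0 ≤ e₁)
    (hsK : s ≤ K * dx) (hV0 : 0 ≤ V) (hV : V ≤ W + μ * e)
    (he : e ≤ e₁ + e₂) (he0 : 0 ≤ e) (he₁r : (r₂ - M) * e₁ ≤ M * s + (Q + (2 * M + r₂)) * dy)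
    (he₂ : r₂ * e₂ ^ 2 ≤ r₁ * dz ^ 2) :
    r₁ / 32 * dx ^ 2 + r₂ / 15 * (dy + α * M * s) ^ 2 + r₁ * B / 5 * dz ^ 2
        + r₂ * N / 4 * V ^ 2
      ≤ (T - (r₁ + L) / 2) * dx ^ 2 + Q * dy ^ 2 - 2 * (M * (s + dy) * dy)
        + (r₂ - M) / 2 * dy ^ 2 - (r₂ + M) * dy ^ 2 + r₁ / 2 * (2 * B - 1) * dz ^ 2
        + r₂ / 2 * (2 * N - 1) * W ^ 2 - 4 * r₁ * dz ^ 2 - 3 / 8 * (r₁ * B) * dz ^ 2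
        - 16 * (β * (r₂ * V ^ 2)) - 16 * (r₁ * β * e ^ 2) := by
  -- In `descent`, `dx, dy, dz, W` are the lengths of the moves of x, y, z, v, and `V` is ‖w - v‖.
  -- Further, `s` is ‖xp - xs‖, while `e`, `e₁`, `e₂` are ‖yp - y₁‖, ‖yp - y₀‖, ‖y₀ - y₁‖. All
  -- errors are reduced to multiples of M dx², Q dy², r₁ dz² and r₂ V².
  have hQ0 : 0 < Q := by linarith
  have hr₁0 : 0 < r₁ := by linarith
  have hr₂0 : 0 < r₂ := by linarith
  have hs2 : s ^ 2 ≤ K ^ 2 * dx ^ 2 := by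
    rw [← mul_pow]; exact pow_le_pow_left₀ hs hsK 2
  have hMs2 : 3 * (M * s ^ 2) ≤ 2 * (Q * dx ^ 2) := by
    have h1 := mul_le_mul_of_nonneg_left hs2 hM.le
    have h2 := mul_le_mul_of_nonneg_right hQK (sq_nonneg dx)
    linarith
  have hcross : 2 * (M * s * dy) ≤ M * dx ^ 2 + 2 / 3 * (Q * dy ^ 2) := by
    have h1 : M * s * dy ≤ M * (K * dx) * dy :=
      mul_le_mul_of_nonneg_right (mul_le_mul_of_nonneg_left hsK hM.le) hdy
    have h2 : 0 ≤ M * (dx - K * dy) ^ 2 := mul_nonneg hM.le (sq_nonneg _)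
    have h3 := mul_le_mul_of_nonneg_right hQK (sq_nonneg dy)
    linarith
  have hαM : α * (M * s) ^ 2 ≤ 2 / 3 * (M * dx ^ 2) := by
    have h1 := mul_le_mul_of_nonneg_left hMs2 (mul_nonneg hα.le hM.le)
    have h2 : α * M * (2 * (Q * dx ^ 2)) = 2 * (α * Q) * (M * dx ^ 2) := by ring
    rw [h2, hQ] at h1
    linarith
  have hαr : 6 * (α * (2 * M + r₂)) ≤ 1 := by
    have := mul_le_mul_of_nonneg_left hQM hα.le
    rw [hQ] at this; linarith
  have hαr₂ : 6 * (α * r₂) ≤ 1 := by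
    have := mul_pos hα hM
    linarith
  have hproj : r₂ / 15 * (dy + α * M * s) ^ 2 ≤ 2 / 15 * (r₂ * dy ^ 2) + 2 / 135 * (M * dx ^ 2) := by
    have h1 : (dy + α * M * s) ^ 2 ≤ 2 * dy ^ 2 + 2 * (α * (α * (M * s) ^ 2)) := by
      linarith [sq_nonneg (dy - α * M * s)]
    have h2 := mul_le_mul_of_nonneg_left hαM (mul_pos hr₂0 hα).le
    have h3 := mul_le_mul_of_nonneg_right hαr₂ (mul_nonneg hM.le (sq_nonneg dx))
    have h4 := mul_le_mul_of_nonneg_left h1 (show 0 ≤ r₂ / 15 by positivity)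
    linarith
  -- Doubling `he₁r` uses r₂ - M ≥ r₂/2, and 2(1 + 1/6) = 7/3 comes from 6(2M + r₂) ≤ Q.
  have he₁' : r₂ * e₁ ≤ 2 * (M * s) + 7 / 3 * (Q * dy) := by
    have h1 := mul_le_mul_of_nonneg_right hr₂ he₁
    have h2 := mul_le_mul_of_nonneg_right hQM hdy
    linarith
  have he₁sq : α * (r₂ * e₁) ^ 2 ≤ 16 / 3 * (M * dx ^ 2) + 98 / 9 * (Q * dy ^ 2) := by
    have h1 := pow_le_pow_left₀ (mul_nonneg hr₂0.le he₁) he₁' 2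
    have h2 : (2 * (M * s) + 7 / 3 * (Q * dy)) ^ 2 ≤ 8 * (M * s) ^ 2 + 98 / 9 * (Q * dy) ^ 2 := by
      linarith [sq_nonneg (2 * (M * s) - 7 / 3 * (Q * dy))]
    have h3 := mul_le_mul_of_nonneg_left (h1.trans h2) hα.le
    have h4 : α * (Q * dy) ^ 2 = Q * dy ^ 2 := by
      rw [show α * (Q * dy) ^ 2 = (α * Q) * (Q * dy ^ 2) by ring, hQ, one_mul]
    linarith
  have hM2 : 4 * M ^ 2 ≤ r₂ ^ 2 := by
    have := pow_le_pow_left₀ (by positivity) hr₂ 2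
    linarith
  have heM : α * M ^ 2 * e ^ 2 ≤
      8 / 3 * (M * dx ^ 2) + 49 / 9 * (Q * dy ^ 2) + 1 / 12 * (r₁ * dz ^ 2) := by
    have h1 : e ^ 2 ≤ 2 * e₁ ^ 2 + 2 * e₂ ^ 2 := by
      have := pow_le_pow_left₀ he0 he 2
      linarith [sq_nonneg (e₁ - e₂)]
    have h2 := mul_le_mul_of_nonneg_left h1 (mul_nonneg hα.le (sq_nonneg M))
    have h3 := mul_le_mul_of_nonneg_left hM2 (mul_nonneg hα.le (sq_nonneg e₁))
    have h4 := mul_le_mul_of_nonneg_left hM2 (mul_nonneg hα.le (sq_nonneg e₂))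
    have h5 := mul_le_mul_of_nonneg_left he₂ (mul_pos hα hr₂0).le
    have h6 := mul_le_mul_of_nonneg_right hαr₂ (mul_nonneg hr₁0.le (sq_nonneg dz))
    linarith
  -- The constants 1920 and 320 bound 16r₁βe² and r₂μe² by αM²e²/120 and αM²e²/320, which `heM` then
  -- controls.
  have hβe := mul_le_mul_of_nonneg_right hβα (sq_nonneg e)
  have hμe := mul_le_mul_of_nonneg_right hμα (sq_nonneg e)
  -- The decrease is available for the actual move `W` but wanted for the ideal move `V`. Half the
  -- coefficient is given up in V² ≤ 2W² + 2(μe)².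
  have hVW : r₂ / 4 * (2 * N - 1) * V ^ 2 - r₂ * μ * e ^ 2 ≤ r₂ / 2 * (2 * N - 1) * W ^ 2 := by
    have h1 : V ^ 2 ≤ 2 * W ^ 2 + 2 * (μ * e) ^ 2 := by
      have := pow_le_pow_left₀ hV0 hV 2
      linarith [sq_nonneg (W - μ * e)]
    have h2 := mul_le_mul_of_nonneg_left h1 (show 0 ≤ r₂ / 4 * (2 * N - 1) from
      mul_nonneg (by positivity) (by linarith))
    have h3 : r₂ * N * (μ * e) ^ 2 = r₂ * μ * e ^ 2 := by
      rw [show r₂ * N * (μ * e) ^ 2 = (μ * N) * (r₂ * μ * e ^ 2) by ring, hN, one_mul]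
    have h4 : 0 ≤ r₂ * (μ * e) ^ 2 := by positivity
    linarith
  have hVN : r₂ * N / 4 * V ^ 2 + 16 * (β * (r₂ * V ^ 2)) ≤ r₂ / 4 * (2 * N - 1) * V ^ 2 := by
    have h1 : 0 ≤ r₂ * V ^ 2 := by positivity
    have h2 := mul_le_mul_of_nonneg_right hβ' h1
    have h3 := mul_le_mul_of_nonneg_right hN2 h1
    linarith
  have hdzB : 100 * (r₁ * dz ^ 2) ≤ r₁ * B * dz ^ 2 := by
    have := mul_le_mul_of_nonneg_right hB (show 0 ≤ r₁ * dz ^ 2 by positivity)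
    linarith
  have hdx1 := mul_le_mul_of_nonneg_right hT (sq_nonneg dx)
  have hdx2 := mul_le_mul_of_nonneg_right hT' (sq_nonneg dx)
  have hdx3 := mul_nonneg hL.le (sq_nonneg dx)
  have hdx4 := mul_nonneg hr₁0.le (sq_nonneg dx)
  have hdy1 := mul_le_mul_of_nonneg_right hQM (sq_nonneg dy)
  have hdy2 := mul_le_mul_of_nonneg_right hr₂ (sq_nonneg dy)
  have hdy3 := mul_nonneg hM.le (sq_nonneg dy)
  have hdx5 := mul_nonneg hM.le (sq_nonneg dx)
  have hdz0 := mul_nonneg hr₁0.le (sq_nonneg dz)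
  linarith

namespace SmoothOnProd

variable {X : Set E} {Y : Set F} {f : E → F → ℝ} {gx : E → F → E} {gy : E → F → F} {L M r₁ r₂ : ℝ}

/-- One step of doubly smoothed gradient descent-ascent decreases the Lyapunov function. -/
theorem descent (h : SmoothOnProd X Y f gx gy L M) {τ α β μ K : ℝ}
    (hL : 0 < L) (hM : 0 < M) (hr₁ : 2 * L ≤ r₁) (hr₂ : 2 * M ≤ r₂)
    (hτ : 0 < τ) (hα : 0 < α) (hβ : 0 < β) (hμ : 0 < μ)
    (hτ₁ : 3 * (L + r₁) ≤ 4 * (1 / τ)) (hτ₂ : 6 * M ≤ 1 / τ)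
    (hK : 1 + τ * (L + r₁) ≤ K * (τ * (r₁ - L))) (hα₁ : 3 * (M * K ^ 2) ≤ 2 * (1 / α))
    (hα₂ : 6 * (2 * M + r₂) ≤ 1 / α) (hβ₁ : β ≤ 1 / 100)
    (hβ₂ : 1920 * (r₁ * β) ≤ α * M ^ 2) (hμ₁ : μ ≤ 1 / 2) (hμ₂ : 320 * (r₂ * μ) ≤ α * M ^ 2)
    {x xp xs xs' z zp x₁ x₂ x₃ x₄ : E} {y yp yk v vp w q y₁ y₂ y₃ y₄ : F}
    (hx : x ∈ X) (hy : y ∈ Y)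
    (hxp : IsProj X (x - τ • (gx x y + r₁ • (x - z))) xp)
    (hyp : IsProj Y (y + α • (gy xp y - r₂ • (y - v))) yp)
    (hzp : zp = z + β • (xp - z)) (hvp : vp = v + μ • (yp - v))
    (hxs : LeftOpt X gx r₁ xs y z) (hxs' : LeftOpt X gx r₁ xs' yp zp)
    (hyk : IsProj Y (y + α • (gy xs y - r₂ • (y - v))) yk)
    (hx₁ : LeftOpt X gx r₁ x₁ y₁ zp) (hy₁ : RightOpt Y gy r₂ x₁ y₁ v)
    (hw : w = v + μ • (y₁ - v))
    (hx₂ : LeftOpt X gx r₁ x₂ y₂ zp) (hy₂ : RightOpt Y gy r₂ x₂ y₂ w)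
    (hx₃ : LeftOpt X gx r₁ x₃ y₃ zp) (hy₃ : RightOpt Y gy r₂ x₃ y₃ q)
    (hx₄ : LeftOpt X gx r₁ x₄ y₄ z) (hy₄ : RightOpt Y gy r₂ x₄ y₄ q) :
    r₁ / 32 * ‖xp - x‖ ^ 2 + r₂ / 15 * ‖y - yk‖ ^ 2 + r₁ / (5 * β) * ‖z - zp‖ ^ 2
        + r₂ / (4 * μ) * ‖w - v‖ ^ 2 - 4 * r₁ * β * ‖x₃ - x₂‖ ^ 2 ≤
      (regularize f r₁ r₂ x y z v - regularize f r₁ r₂ xp yp zp vp)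
      + 2 * (regularize f r₁ r₂ xs' yp zp vp - regularize f r₁ r₂ xs y z v)
      + 2 * (regularize f r₁ r₂ x₄ y₄ z q - regularize f r₁ r₂ x₃ y₃ zp q) := by
  have hr₁0 : 0 < r₁ := by linarith
  have hr₂0 : 0 < r₂ := by linarith
  -- The saddle point at the old centres `(z, v)` links `yp` to `y₁`: the dual error bound gives
  -- `yp` to `y₀`, and stability in the primal centre gives `y₀` to `y₁`.
  obtain ⟨x₀, y₀, hx₀, hy₀⟩ := h.exists_saddle hL hr₁ (by linarith : M ≤ r₂) z v
  -- primal descent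
  have hF₁ := h.regularize_primal_step (r₂ := r₂) (v := v) hτ hx hy hxp
  have hF₂ := h.regularize_right_upper (r₁ := r₁) (r₂ := r₂) (z := z) (v := v) hxp.1 hy hyp.1
  have hΔz : zp - z = β • (xp - z) := by rw [hzp]; abel
  have hΔv : vp - v = μ • (yp - v) := by rw [hvp]; abel
  have hzi : ⟪zp - z, xp - z⟫ = 1 / β * ‖zp - z‖ ^ 2 := by
    rw [hΔz, real_inner_smul_left, real_inner_self_eq_norm_sq, norm_smul,
      Real.norm_of_nonneg hβ.le]
    field_simp
  have hvi : ⟪vp - v, yp - v⟫ = 1 / μ * ‖vp - v‖ ^ 2 := by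
    rw [hΔv, real_inner_smul_left, real_inner_self_eq_norm_sq, norm_smul,
      Real.norm_of_nonneg hμ.le]
    field_simp
  have hsq : ∀ u : E, ‖u - zp‖ ^ 2 = ‖u - z‖ ^ 2 - 2 * ⟪zp - z, u - z⟫ + ‖zp - z‖ ^ 2 := fun u => by
    rw [show u - zp = (u - z) - (zp - z) by abel, norm_sub_sq_real, real_inner_comm]
  have hsqv : ‖yp - vp‖ ^ 2 = ‖yp - v‖ ^ 2 - 2 * ⟪vp - v, yp - v⟫ + ‖vp - v‖ ^ 2 := by
    rw [show yp - vp = (yp - v) - (vp - v) by abel, norm_sub_sq_real, real_inner_comm]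
  have hF₃ : regularize f r₁ r₂ xp yp z v - regularize f r₁ r₂ xp yp zp vp =
      r₁ / 2 * (2 * (1 / β) - 1) * ‖zp - z‖ ^ 2 - r₂ / 2 * (2 * (1 / μ) - 1) * ‖vp - v‖ ^ 2 := by
    unfold regularize
    rw [hsq, hsqv, hzi, hvi]; ring
  -- dual ascent
  have hD₁ := h.dual_value_sub_ge (r₂ := r₂) (v := v) hL hM hr₁ hxp.1 hy hyp.1 hxs hxs'
  have hD₂ : regularize f r₁ r₂ xs' yp zp vp - regularize f r₁ r₂ xs' yp z v =
      r₁ / 2 * (‖zp - z‖ ^ 2 - 2 * ⟪zp - z, xs' - z⟫)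
        + r₂ / 2 * (2 * (1 / μ) - 1) * ‖vp - v‖ ^ 2 := by
    unfold regularize
    rw [hsq, hsqv, hvi]; ring
  -- proximal descent
  have hP := h.saddle_value_sub_ge (by linarith : L ≤ r₁) (by linarith : M ≤ r₂) hx₄ hy₄ hx₃ hy₃
  -- This pairing enters χ once and 2φ_π twice, so one copy survives with a favourable sign.
  have hG : 1 / α * ‖yp - y‖ ^ 2 ≤ ⟪gy xp y - r₂ • (y - v), yp - y⟫ := by
    have h2 := hyp.2 y hy
    have e1 : y - yp = -(yp - y) := by abel
    have e2 : y + α • (gy xp y - r₂ • (y - v)) - yp =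
      -(yp - y) + α • (gy xp y - r₂ • (y - v)) := by abel
    rw [e1, e2, inner_neg_right, inner_add_left, inner_neg_left, real_inner_self_eq_norm_sq,
      real_inner_smul_left] at h2
    rw [one_div, inv_mul_le_iff₀ hα]
    linarith
  -- error bounds
  have hs : ‖xp - xs‖ ≤ K * ‖xp - x‖ := by
    have h1 := h.norm_primal_step_sub_le hτ hL hr₁0.le hx hy hxp hxs
    have h2 := mul_le_mul_of_nonneg_right hK (norm_nonneg (xp - x))
    have h3 : 0 < τ * (r₁ - L) := mul_pos hτ (by linarith)
    refine le_of_mul_le_mul_left (h1.trans (h2.trans_eq ?_)) h3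
    ring
  have he₁ : (r₂ - M) * ‖yp - y₀‖ ≤ M * ‖xp - xs‖ + (1 / α + (2 * M + r₂)) * ‖yp - y‖ := by
    have h1 := h.norm_dual_step_sub_le hα hL hM hr₁ hr₂0.le hxp.1 hy hyp hxs hx₀ hy₀
    refine le_of_mul_le_mul_left (h1.trans' (le_of_eq (by ring)) |>.trans_eq ?_) hα
    field_simp
  have he₂ : r₂ * ‖y₀ - y₁‖ ^ 2 ≤ r₁ * ‖zp - z‖ ^ 2 := by
    rw [norm_sub_rev zp z]
    exact h.saddle_right_centre_le hL hr₁ hr₂ hx₀ hy₀ hx₁ hy₁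
  have he : ‖yp - y₁‖ ≤ ‖yp - y₀‖ + ‖y₀ - y₁‖ := norm_sub_le_norm_sub_add_norm_sub _ _ _
  have hV : ‖w - v‖ ≤ ‖vp - v‖ + μ * ‖yp - y₁‖ := by
    have e1 : w - v = (vp - v) - μ • (yp - y₁) := by rw [hw, hvp]; module
    rw [e1]
    refine (norm_sub_le _ _).trans_eq ?_
    rw [norm_smul, Real.norm_of_nonneg hμ.le]
  have hyk' : ‖y - yk‖ ≤ ‖yp - y‖ + α * M * ‖xp - xs‖ := by
    have h1 := hyp.norm_sub_le hyk
    have e1 : (y + α • (gy xp y - r₂ • (y - v))) - (y + α • (gy xs y - r₂ • (y - v))) =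
      α • (gy xp y - gy xs y) := by module
    rw [e1, norm_smul, Real.norm_of_nonneg hα.le] at h1
    have h2 := h.lip_right xp hxp.1 xs hxs.1 y hy y hy
    rw [sub_self, norm_zero, add_zero] at h2
    have h3 := mul_le_mul_of_nonneg_left h2 hα.le
    have h4 := norm_sub_le_norm_sub_add_norm_sub y yp yk
    rw [norm_sub_rev y yp] at h4
    linarith
  -- the cross term
  have ht₁ : ‖x₄ - x₃‖ ≤ 2 * ‖zp - z‖ := by
    rw [norm_sub_rev zp z]
    exact h.saddle_left_centre_le hL hr₁ (by linarith) hx₄ hy₄ hx₃ hy₃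
  have ht₃ : r₁ * ‖x₂ - x₁‖ ^ 2 ≤ r₂ * ‖w - v‖ ^ 2 :=
    h.saddle_left_dual_centre_le hr₁ hM hr₂ hx₂ hy₂ hx₁ hy₁
  have ht₄ : ‖x₁ - xs'‖ ≤ ‖yp - y₁‖ := by
    rw [norm_sub_rev yp y₁]
    exact h.norm_leftOpt_sub_le hL hr₁ hy₁.1 hyp.1 hx₁ hxs'
  have young : ∀ c : ℝ, 0 < c → ∀ u : E,
      -(2 * ⟪zp - z, u⟫) ≤ c * (1 / β) * ‖zp - z‖ ^ 2 + 1 / c * β * ‖u‖ ^ 2 := by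
    intro c hc u
    have h1 : -⟪zp - z, u⟫ ≤ ‖zp - z‖ * ‖u‖ := by
      rw [← inner_neg_left, ← norm_neg (zp - z)]; exact real_inner_le_norm _ _
    have h2 : 0 ≤ 1 / (c * β) * (c * ‖zp - z‖ - β * ‖u‖) ^ 2 := by positivity
    have h3 : 1 / (c * β) * (c * ‖zp - z‖ - β * ‖u‖) ^ 2 =
        c * (1 / β) * ‖zp - z‖ ^ 2 + 1 / c * β * ‖u‖ ^ 2 - 2 * (‖zp - z‖ * ‖u‖) := by
      field_simp; ring
    linarith
  have hcross : -(2 * ⟪zp - z, x₄ - xs'⟫) ≤ 4 * ‖zp - z‖ ^ 2 + 3 / 8 * (1 / β) * ‖zp - z‖ ^ 2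
      + 4 * β * ‖x₃ - x₂‖ ^ 2 + 16 * β * ‖x₂ - x₁‖ ^ 2 + 16 * β * ‖yp - y₁‖ ^ 2 := by
    -- Successive links change the primal centre, the dual centre from `q` to `w`, the dual centre
    -- from `w` to `v`, and finally `y₁` to `yp`. The weights 1/4, 1/16, 1/16 sum to half of 3/4,
    -- that is 3/8, and the first yields the coefficient 4r₁β of the conclusion.
    have e1 : x₄ - xs' = (x₄ - x₃) + (x₃ - x₂) + (x₂ - x₁) + (x₁ - xs') := by abel
    have h1 : -⟪zp - z, x₄ - x₃⟫ ≤ 2 * ‖zp - z‖ ^ 2 := by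
      rw [← inner_neg_left]
      refine (real_inner_le_norm _ _).trans ?_
      rw [norm_neg]
      have := mul_le_mul_of_nonneg_left ht₁ (norm_nonneg (zp - z))
      linarith
    have h2 := young (1 / 4) (by norm_num) (x₃ - x₂)
    have h3 := young (1 / 16) (by norm_num) (x₂ - x₁)
    have h4 := young (1 / 16) (by norm_num) (x₁ - xs')
    have h5 : β * ‖x₁ - xs'‖ ^ 2 ≤ β * ‖yp - y₁‖ ^ 2 :=
      mul_le_mul_of_nonneg_left (pow_le_pow_left₀ (norm_nonneg _) ht₄ 2) hβ.le
    rw [e1, inner_add_right, inner_add_right, inner_add_right]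
    linarith
  have hcross' := mul_le_mul_of_nonneg_left hcross hr₁0.le
  have ht₃' := mul_le_mul_of_nonneg_left ht₃ hβ.le
  have hB : 100 ≤ 1 / β := by
    rw [le_div_iff₀ hβ]; linarith
  have hN : 2 ≤ 1 / μ := by
    rw [le_div_iff₀ hμ]; linarith
  have main := descent_scalar (T := 1 / τ) hL hM hr₁ hr₂ hα hβ (mul_one_div_cancel hα.ne')
    (mul_one_div_cancel hμ.ne') hτ₁ hτ₂ hα₁ hα₂ hB hβ₁ hβ₂ hN hμ₂
    (norm_nonneg (yp - y)) (norm_nonneg _) (norm_nonneg _) hs (norm_nonneg _) hV he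
    (norm_nonneg _) he₁ he₂
  have hyk2 : r₂ / 15 * ‖y - yk‖ ^ 2 ≤ r₂ / 15 * (‖yp - y‖ + α * M * ‖xp - xs‖) ^ 2 :=
    mul_le_mul_of_nonneg_left (pow_le_pow_left₀ (norm_nonneg _) hyk' 2) (by positivity)
  have hc₁ : r₁ / (5 * β) * ‖z - zp‖ ^ 2 = r₁ * (1 / β) / 5 * ‖zp - z‖ ^ 2 := by
    rw [norm_sub_rev]; field_simp
  have hc₂ : r₂ / (4 * μ) * ‖w - v‖ ^ 2 = r₂ * (1 / μ) / 4 * ‖w - v‖ ^ 2 := by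
    field_simp
  rw [hc₁, hc₂]
  rw [inner_sub_right] at hcross'
  have hzx : ⟪zp - z, x₄ - z⟫ - ⟪zp - z, xs' - z⟫ = ⟪zp - z, x₄⟫ - ⟪zp - z, xs'⟫ := by
    rw [inner_sub_right, inner_sub_right]; ring
  have hzx' : r₁ * ⟪zp - z, x₄ - z⟫ - r₁ * ⟪zp - z, xs' - z⟫ =
      r₁ * ⟪zp - z, x₄⟫ - r₁ * ⟪zp - z, xs'⟫ := by
    rw [← mul_sub, hzx, mul_sub]
  linarith

end SmoothOnProd

end SaddlePoints

/-! ### Tools on linearization, projections, extrema and gradients. -/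

/-- A function whose gradient is Lipschitz continuous on a convex set is approximated by its
linearization up to a quadratic term. -/
lemma abs_sub_linearization_le {E : Type*} [NormedAddCommGroup E] [InnerProductSpace ℝ E]
    [CompleteSpace E] {X : Set E} (hX : Convex ℝ X) {φ : E → ℝ} {g : E → E} {L : ℝ}
    (hg : ∀ x ∈ X, HasGradientAt φ (g x) x)
    (hL : ∀ x ∈ X, ∀ x' ∈ X, ‖g x - g x'‖ ≤ L * ‖x - x'‖) {x x' : E} (hx : x ∈ X) (hx' : x' ∈ X) :
    |φ x' - φ x - ⟪g x, x' - x⟫| ≤ L / 2 * ‖x' - x‖ ^ 2 := by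
  set d := x' - x with hd
  have hmem : ∀ t ∈ Set.Icc (0 : ℝ) 1, x + t • d ∈ X := fun t ht =>
    hX.add_smul_sub_mem hx hx' ht
  have hder : ∀ t ∈ Set.Icc (0 : ℝ) 1,
      HasDerivAt (fun t : ℝ => φ (x + t • d) - φ x - t * ⟪g x, d⟫)
        (⟪g (x + t • d), d⟫ - ⟪g x, d⟫) t := by
    intro t ht
    have h1 : HasDerivAt (fun t : ℝ => x + t • d) d t := by
      simpa using ((hasDerivAt_id t).smul_const d).const_add x
    have h2 := (hg _ (hmem t ht)).hasFDerivAt.comp_hasDerivAt t h1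
    have h3 := (h2.sub_const (φ x)).sub ((hasDerivAt_id t).mul_const ⟪g x, d⟫)
    exact h3.congr_deriv (by simp)
  have hB : ∀ t : ℝ, HasDerivAt (fun t : ℝ => L / 2 * ‖d‖ ^ 2 * t ^ 2) (L * ‖d‖ ^ 2 * t) t := by
    intro t
    have := ((hasDerivAt_id t).pow 2).const_mul (L / 2 * ‖d‖ ^ 2)
    exact this.congr_deriv (by simp; ring)
  -- Along the segment the remainder has derivative at most L‖d‖²t in absolute value, the derivative
  -- of the claimed bound.
  have key := image_norm_le_of_norm_deriv_right_le_deriv_boundary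
    (f := fun t : ℝ => φ (x + t • d) - φ x - t * ⟪g x, d⟫) (a := 0) (b := 1)
    (fun t ht => (hder t ht).continuousAt.continuousWithinAt)
    (fun t ht => (hder t ⟨ht.1, ht.2.le⟩).hasDerivWithinAt) (by simp) hB
    (fun t ht => by
      rw [← inner_sub_left]
      refine (norm_inner_le_norm _ _).trans ?_
      have h1 := hL _ (hmem t ⟨ht.1, ht.2.le⟩) x hx
      rw [add_sub_cancel_left, norm_smul, Real.norm_of_nonneg ht.1] at h1
      have h2 := mul_le_mul_of_nonneg_right h1 (norm_nonneg d)
      linarith) (Set.right_mem_Icc.mpr zero_le_one)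
  simpa [hd] using key

lemma IsProj.of_isMinOn {E : Type*} [NormedAddCommGroup E] [InnerProductSpace ℝ E] {K : Set E}
    (hK : Convex ℝ K) {u p : E} (hp : p ∈ K) (hmin : IsMinOn (fun y => ‖y - u‖) K p) :
    IsProj K u p := by
  refine ⟨hp, fun w hw => ?_⟩
  have hmin2 : IsMinOn (fun y => ‖y - u‖ ^ 2) K p := fun y hy =>
    pow_le_pow_left₀ (norm_nonneg _) (hmin hy) 2
  have := inner_nonneg_of_isMinOn (g := (2 : ℝ) • (p - u)) (c := 1) hK hp hmin2 (fun y _ => by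
    rw [norm_sub_sq_expand p y u, real_inner_smul_left]; linarith) w hw
  rw [real_inner_smul_left] at this
  rw [← neg_sub p u, inner_neg_left]
  linarith

lemma argminOn_spec {E : Type*} [Nonempty E] {f : E → ℝ} {K : Set E}
    (h : ∃ x ∈ K, IsMinOn f K x) : argminOn f K ∈ K ∧ IsMinOn f K (argminOn f K) :=
  Classical.epsilon_spec h

lemma argmaxOn_spec {E : Type*} [Nonempty E] {f : E → ℝ} {K : Set E}
    (h : ∃ x ∈ K, IsMaxOn f K x) : argmaxOn f K ∈ K ∧ IsMaxOn f K (argmaxOn f K) :=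
  Classical.epsilon_spec h

lemma minVal_eq {E : Type*} {f : E → ℝ} {K : Set E} {x : E} (hx : x ∈ K) (h : IsMinOn f K x) :
    minVal f K = f x :=
  IsLeast.csInf_eq ⟨Set.mem_image_of_mem f hx, by rintro _ ⟨y, hy, rfl⟩; exact h hy⟩

lemma maxVal_eq {E : Type*} {f : E → ℝ} {K : Set E} {x : E} (hx : x ∈ K) (h : IsMaxOn f K x) :
    maxVal f K = f x :=
  IsGreatest.csSup_eq ⟨Set.mem_image_of_mem f hx, by rintro _ ⟨y, hy, rfl⟩; exact h hy⟩

lemma euclProj_isProj {E : Type*} [NormedAddCommGroup E] [InnerProductSpace ℝ E] {K : Set E}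
    (hK : Convex ℝ K) (hc : IsCompact K) (hne : K.Nonempty) (u : E) :
    IsProj K u (euclProj K u) := by
  have h := argminOn_spec (f := fun y => ‖y - u‖) (hc.exists_isMinOn hne (by fun_prop))
  exact IsProj.of_isMinOn hK h.1 h.2

lemma ContDiffOn.exists_fderiv_lipschitz {W : Type*} [NormedAddCommGroup W] [NormedSpace ℝ W]
    {φ : W → ℝ} {U K : Set W} (hφ : ContDiffOn ℝ 2 φ U) (hU : IsOpen U) (hK : IsCompact K)
    (hKc : Convex ℝ K) (hKU : K ⊆ U) :
    ∃ C > 0, ∀ w ∈ K, ∀ w' ∈ K, ‖fderiv ℝ φ w - fderiv ℝ φ w'‖ ≤ C * ‖w - w'‖ := by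
  have hG : ContDiffOn ℝ 1 (fderiv ℝ φ) U := hφ.fderiv_of_isOpen hU (by norm_num)
  have hG' : ContinuousOn (fderiv ℝ (fderiv ℝ φ)) K :=
    (hG.continuousOn_fderiv_of_isOpen hU le_rfl).mono hKU
  obtain ⟨C, hC⟩ := hK.exists_bound_of_continuousOn (E := W →L[ℝ] W →L[ℝ] ℝ) hG'
  refine ⟨max C 1, by positivity, fun w hw w' hw' => ?_⟩
  refine hKc.norm_image_sub_le_of_norm_fderiv_le (fun x hx => ?_)
    (fun x hx => (hC x hx).trans (le_max_left _ _)) hw' hw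
  exact (hG.differentiableOn (by norm_num)).differentiableAt (hU.mem_nhds (hKU hx))

lemma isCompact_of_isClosed_of_mem_Icc {ι : Type*} [Fintype ι] {K : Set (EuclideanSpace ℝ ι)}
    (hK : IsClosed K) (h : ∀ x ∈ K, ∀ i, x i ∈ Set.Icc (0 : ℝ) 1) : IsCompact K := by
  have hc : IsCompact ((EuclideanSpace.equiv ι ℝ).toHomeomorph ⁻¹' Set.pi Set.univ
      fun _ : ι => Set.Icc (0 : ℝ) 1) :=
    (EuclideanSpace.equiv ι ℝ).toHomeomorph.isCompact_preimage.mpr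
      (isCompact_univ_pi fun _ => isCompact_Icc)
  exact hc.of_isClosed_subset hK fun x hx i _ => h x hx i

lemma norm_gradient_sub_le {E : Type*} [NormedAddCommGroup E] [InnerProductSpace ℝ E]
    [CompleteSpace E] {φ ψ : E → ℝ} {φ' ψ' : StrongDual ℝ E} {x y : E} (hφ : HasFDerivAt φ φ' x)
    (hψ : HasFDerivAt ψ ψ' y) : ‖gradient φ x - gradient ψ y‖ = ‖φ' - ψ'‖ := by
  rw [gradient, gradient, hφ.fderiv, hψ.fderiv, ← map_sub, LinearIsometryEquiv.norm_map]

lemma hasGradientAt_norm_sub_sq {E : Type*} [NormedAddCommGroup E] [InnerProductSpace ℝ E]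
    [CompleteSpace E] (z x : E) (r : ℝ) :
    HasGradientAt (fun x => r / 2 * ‖x - z‖ ^ 2) (r • (x - z)) x := by
  rw [hasGradientAt_iff_hasFDerivAt]
  have h1 := (((hasFDerivAt_id x).sub_const z).norm_sq).const_mul (r / 2)
  refine h1.congr_fderiv ?_
  ext u
  simp
  ring

/-! ### Smoothness of the objective on the policy and ambiguity sets. -/

namespace RMDP

variable {S A : Type*} [Fintype S] [Fintype A]

lemma isClosed_Pi (M : RMDP S A) : IsClosed M.Pi := by
  have : M.Pi = ⋂ s, (fun π : PolSpace S A => fun a => π (s, a)) ⁻¹' stdSimplex ℝ A := by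
    ext; simp [Pi]
  rw [this]
  exact isClosed_iInter fun s => (isClosed_stdSimplex ℝ A).preimage (by fun_prop)

lemma isClosed_P (M : RMDP S A) : IsClosed M.P := by
  have : M.P = ⋂ s, (fun p : KerSpace S A => fun a s' => p (s, a, s')) ⁻¹' M.amb s := by
    ext; simp [P]
  rw [this]
  exact isClosed_iInter fun s => (M.amb_closed s).preimage (by fun_prop)

lemma isCompact_Pi (M : RMDP S A) : IsCompact M.Pi :=
  isCompact_of_isClosed_of_mem_Icc M.isClosed_Pi fun _ hx i => mem_Icc_of_mem_stdSimplex (hx i.1) i.2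

lemma isCompact_P (M : RMDP S A) : IsCompact M.P :=
  isCompact_of_isClosed_of_mem_Icc M.isClosed_P fun _ hx i =>
    mem_Icc_of_mem_stdSimplex (M.amb_simplex i.1 _ (hx i.1) i.2.1) i.2.2

lemma convex_Pi (M : RMDP S A) : Convex ℝ M.Pi := fun _ hx _ hy _ _ ha hb hab s =>
  convex_stdSimplex ℝ A (hx s) (hy s) ha hb hab

lemma convex_P (M : RMDP S A) : Convex ℝ M.P := fun _ hx _ hy _ _ ha hb hab s =>
  M.amb_convex s (hx s) (hy s) ha hb hab

section Smoothness

attribute [local instance] Matrix.linftyOpNormedRing Matrix.linftyOpNormedAlgebra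

variable [DecidableEq S]

lemma contDiff_transMat :
    ContDiff ℝ 2 fun w : PolSpace S A × KerSpace S A => transMat w.1 w.2 := by
  have h1 : ContDiff ℝ 2 fun w : PolSpace S A × KerSpace S A =>
      fun s s' => ∑ a, w.1 (s, a) * w.2 (s, a, s') := by
    refine contDiff_pi.mpr fun s => contDiff_pi.mpr fun s' => ?_
    exact ContDiff.sum fun a _ => by fun_prop
  let e : (S → S → ℝ) →L[ℝ] Matrix S S ℝ :=
    (Matrix.ofLinearEquiv ℝ : (S → S → ℝ) ≃ₗ[ℝ] Matrix S S ℝ).toLinearMap.toContinuousLinearMap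
  exact e.contDiff.comp h1

/-- Pairs at which the Neumann series of the discounted transition matrix converges in norm. -/
def contractive (M : RMDP S A) : Set (PolSpace S A × KerSpace S A) :=
  {w | ‖M.γ • transMat w.1 w.2‖ < 1}

lemma isOpen_contractive (M : RMDP S A) : IsOpen M.contractive :=
  isOpen_lt (((contDiff_transMat (S := S) (A := A)).continuous.const_smul M.γ).norm) continuous_const

/-- The norm is the maximal row sum, in which stochastic matrices have norm at most one, so the
discount makes them strict contractions. -/
lemma norm_transMat_le_one (M : RMDP S A) {π : PolSpace S A} {p : KerSpace S A} (hπ : π ∈ M.Pi)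
    (hp : p ∈ M.P) : ‖transMat π p‖ ≤ 1 := by
  rw [Matrix.linfty_opNorm_def, NNReal.coe_le_one]
  refine Finset.sup_le fun s _ => ?_
  rw [← NNReal.coe_le_one, NNReal.coe_sum]
  have hp' := M.amb_simplex s _ (hp s)
  have hnn : ∀ s', 0 ≤ transMat π p s s' := fun s' =>
    Finset.sum_nonneg fun a _ => mul_nonneg ((hπ s).1 a) ((hp' a).1 s')
  calc ∑ s', ((‖transMat π p s s'‖₊ : NNReal) : ℝ) = ∑ s', transMat π p s s' :=
        Finset.sum_congr rfl fun s' _ => by rw [coe_nnnorm, Real.norm_of_nonneg (hnn s')]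
    _ = ∑ a, π (s, a) * ∑ s', p (s, a, s') := by
        simp only [transMat, Matrix.of_apply, Finset.mul_sum]
        exact Finset.sum_comm
    _ = ∑ a, π (s, a) := Finset.sum_congr rfl fun a _ => by rw [(hp' a).2, mul_one]
    _ ≤ 1 := (hπ s).2.le

lemma prod_subset_contractive (M : RMDP S A) : M.Pi ×ˢ M.P ⊆ M.contractive := by
  rintro ⟨π, p⟩ ⟨hπ, hp⟩
  have h1 := M.norm_transMat_le_one hπ hp
  change ‖M.γ • transMat π p‖ < 1
  refine (norm_smul_le _ _).trans_lt ?_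
  rw [Real.norm_of_nonneg M.γ_pos.le]
  have := mul_le_mul_of_nonneg_left h1 M.γ_pos.le
  have := M.γ_lt_one
  linarith

/-- The discounted sum is a Neumann series. As `contractive` is open, the formula also holds around
the simplices, where the ambient gradients need it. -/
lemma value_eq (M : RMDP S A) {π : PolSpace S A} {p : KerSpace S A}
    (h : (π, p) ∈ M.contractive) (s : S) :
    M.value π p s = ∑ s', Ring.inverse (1 - M.γ • transMat π p) s s' * M.stepCost π p s' := by
  have h1 : HasSum (fun t : ℕ => (M.γ • transMat π p) ^ t) (Ring.inverse (1 - M.γ • transMat π p)) :=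
    hasSum_geom_series_inverse _ h
  have h2 : ∀ s', HasSum (fun t : ℕ => ((M.γ • transMat π p) ^ t) s s')
      (Ring.inverse (1 - M.γ • transMat π p) s s') := fun s' =>
    h1.map (Matrix.entryAddMonoidHom ℝ s s') (by
      exact (Matrix.entryLinearMap ℝ ℝ s s').continuous_of_finiteDimensional)
  have h3 := hasSum_sum fun s' (_ : s' ∈ Finset.univ) => (h2 s').mul_right (M.stepCost π p s')
  rw [← h3.tsum_eq, value]
  refine tsum_congr fun t => ?_
  rw [smul_pow, Finset.mul_sum]
  exact Finset.sum_congr rfl fun s' _ => by rw [Matrix.smul_apply, smul_eq_mul, mul_assoc]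

lemma contDiffOn_J (M : RMDP S A) :
    ContDiffOn ℝ 2 (fun w : PolSpace S A × KerSpace S A => M.J w.1 w.2) M.contractive := by
  have hinv : ContDiffOn ℝ 2 (fun w : PolSpace S A × KerSpace S A =>
      Ring.inverse (1 - M.γ • transMat w.1 w.2)) M.contractive := by
    intro w hw
    have h1 : ContDiffAt ℝ 2 Ring.inverse (1 - M.γ • transMat w.1 w.2) :=
      contDiffAt_ringInverse ℝ (Units.oneSub (M.γ • transMat w.1 w.2) hw)
    have h2 : ContDiffAt ℝ 2 (fun w : PolSpace S A × KerSpace S A =>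
        1 - M.γ • transMat w.1 w.2) w :=
      (contDiff_const.sub ((contDiff_transMat (S := S) (A := A)).const_smul M.γ)).contDiffAt
    exact (h1.comp w h2).contDiffWithinAt
  have hentry : ∀ s s', ContDiffOn ℝ 2 (fun w : PolSpace S A × KerSpace S A =>
      Ring.inverse (1 - M.γ • transMat w.1 w.2) s s') M.contractive := fun s s' =>
    let e : Matrix S S ℝ →L[ℝ] ℝ := (Matrix.entryLinearMap ℝ ℝ s s').toContinuousLinearMap
    e.contDiff.comp_contDiffOn hinv
  have hcost : ∀ s, ContDiff ℝ 2 fun w : PolSpace S A × KerSpace S A => M.stepCost w.1 w.2 s := by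
    intro s
    unfold stepCost
    exact ContDiff.sum fun a _ => ContDiff.sum fun s' _ => by fun_prop
  have hsum : ContDiffOn ℝ 2 (fun w : PolSpace S A × KerSpace S A =>
      ∑ s, M.ρ s * ∑ s', Ring.inverse (1 - M.γ • transMat w.1 w.2) s s' * M.stepCost w.1 w.2 s')
      M.contractive :=
    ContDiffOn.sum fun s _ => contDiffOn_const.mul
      (ContDiffOn.sum fun s' _ => (hentry s s').mul (hcost s').contDiffOn)
  refine hsum.congr fun w hw => ?_
  exact Finset.sum_congr rfl fun s _ => by rw [M.value_eq hw]

end Smoothness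

variable [DecidableEq S]

lemma differentiableAt_J (M : RMDP S A) {π : PolSpace S A} {p : KerSpace S A} (hπ : π ∈ M.Pi)
    (hp : p ∈ M.P) :
    DifferentiableAt ℝ (fun w : PolSpace S A × KerSpace S A => M.J w.1 w.2) (π, p) :=
  (M.contDiffOn_J.differentiableOn (by norm_num)).differentiableAt
    (M.isOpen_contractive.mem_nhds (M.prod_subset_contractive ⟨hπ, hp⟩))

lemma hasFDerivAt_J_pol (M : RMDP S A) {π : PolSpace S A} {p : KerSpace S A} (hπ : π ∈ M.Pi)
    (hp : p ∈ M.P) :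
    HasFDerivAt (fun x => M.J x p)
      ((fderiv ℝ (fun w : PolSpace S A × KerSpace S A => M.J w.1 w.2) (π, p)).comp
        (ContinuousLinearMap.inl ℝ (PolSpace S A) (KerSpace S A))) π :=
  HasFDerivAt.comp (g := fun w : PolSpace S A × KerSpace S A => M.J w.1 w.2)
    (f := fun x => (x, p)) π (M.differentiableAt_J hπ hp).hasFDerivAt (hasFDerivAt_prodMk_left π p)

lemma hasFDerivAt_J_ker (M : RMDP S A) {π : PolSpace S A} {p : KerSpace S A} (hπ : π ∈ M.Pi)
    (hp : p ∈ M.P) :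
    HasFDerivAt (fun y => M.J π y)
      ((fderiv ℝ (fun w : PolSpace S A × KerSpace S A => M.J w.1 w.2) (π, p)).comp
        (ContinuousLinearMap.inr ℝ (PolSpace S A) (KerSpace S A))) p :=
  HasFDerivAt.comp (g := fun w : PolSpace S A × KerSpace S A => M.J w.1 w.2)
    (f := fun y => (π, y)) p (M.differentiableAt_J hπ hp).hasFDerivAt (hasFDerivAt_prodMk_right π p)

lemma exists_fderiv_J_lipschitz (M : RMDP S A) :
    ∃ C > 0, ∀ w ∈ M.Pi ×ˢ M.P, ∀ w' ∈ M.Pi ×ˢ M.P,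
      ‖fderiv ℝ (fun w : PolSpace S A × KerSpace S A => M.J w.1 w.2) w -
        fderiv ℝ (fun w : PolSpace S A × KerSpace S A => M.J w.1 w.2) w'‖ ≤ C * ‖w - w'‖ :=
  M.contDiffOn_J.exists_fderiv_lipschitz M.isOpen_contractive (M.isCompact_Pi.prod M.isCompact_P)
    (M.convex_Pi.prod M.convex_P) M.prod_subset_contractive

theorem exists_gradLipschitz (M : RMDP S A) : ∃ ℓπp > 0, ∃ ℓpπ > 0, M.GradLipschitz ℓπp ℓpπ := by
  obtain ⟨C, hC0, hC⟩ := M.exists_fderiv_J_lipschitz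
  refine ⟨C, hC0, C, hC0, fun π hπ π' hπ' p hp p' hp' => ?_⟩
  have h1 := hC (π, p) ⟨hπ, hp⟩ (π', p') ⟨hπ', hp'⟩
  have h2 : ‖(π, p) - (π', p')‖ ≤ ‖π - π'‖ + ‖p - p'‖ :=
    max_le_add_of_nonneg (norm_nonneg _) (norm_nonneg _)
  have h3 := h1.trans (mul_le_mul_of_nonneg_left h2 hC0.le)
  constructor
  · rw [norm_gradient_sub_le (M.hasFDerivAt_J_pol hπ hp) (M.hasFDerivAt_J_pol hπ' hp'),
      ← ContinuousLinearMap.sub_comp]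
    refine (ContinuousLinearMap.opNorm_comp_le _ _).trans (le_trans ?_ h3)
    exact mul_le_of_le_one_right (norm_nonneg _) (ContinuousLinearMap.norm_inl_le_one ..)
  · rw [norm_gradient_sub_le (M.hasFDerivAt_J_ker hπ hp) (M.hasFDerivAt_J_ker hπ' hp'),
      ← ContinuousLinearMap.sub_comp]
    refine (ContinuousLinearMap.opNorm_comp_le _ _).trans (le_trans ?_ h3)
    exact mul_le_of_le_one_right (norm_nonneg _) (ContinuousLinearMap.norm_inr_le_one ..)

lemma hasGradientAt_J_pol (M : RMDP S A) {π : PolSpace S A} {p : KerSpace S A} (hπ : π ∈ M.Pi)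
    (hp : p ∈ M.P) :
    HasGradientAt (fun x => M.J x p) (gradient (fun x => M.J x p) π) π :=
  (M.hasFDerivAt_J_pol hπ hp).differentiableAt.hasGradientAt

lemma hasGradientAt_J_ker (M : RMDP S A) {π : PolSpace S A} {p : KerSpace S A} (hπ : π ∈ M.Pi)
    (hp : p ∈ M.P) :
    HasGradientAt (fun y => M.J π y) (gradient (fun y => M.J π y) p) p :=
  (M.hasFDerivAt_J_ker hπ hp).differentiableAt.hasGradientAt

theorem smoothOnProd_J (M : RMDP S A) {L K : ℝ} (h : M.GradLipschitz L K) (hπ : M.Pi.Nonempty)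
    (hp : M.P.Nonempty) :
    SmoothOnProd M.Pi M.P M.J (fun π p => gradient (fun x => M.J x p) π)
      (fun π p => gradient (fun y => M.J π y) p) L K where
  convex_left := M.convex_Pi
  convex_right := M.convex_P
  compact_left := M.isCompact_Pi
  compact_right := M.isCompact_P
  nonempty_left := hπ
  nonempty_right := hp
  continuousOn := M.contDiffOn_J.continuousOn.mono M.prod_subset_contractive
  abs_left x hx x' hx' y hy := abs_sub_linearization_le M.convex_Pi
    (fun u hu => M.hasGradientAt_J_pol hu hy)
    (fun u hu u' hu' => by simpa using (h u hu u' hu' y hy y hy).1) hx hx'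
  abs_right x hx y hy y' hy' := abs_sub_linearization_le M.convex_P
    (fun u hu => M.hasGradientAt_J_ker hx hu)
    (fun u hu u' hu' => by simpa using (h x hx x hx u hu u' hu').2) hy hy'
  lip_left x hx x' hx' y hy y' hy' := (h x hx x' hx' y hy y' hy').1
  lip_right x hx x' hx' y hy y' hy' := (h x hx x' hx' y hy y' hy').2

lemma gradPol_eq (M : RMDP S A) {r₁ r₂ : ℝ} {π πb : PolSpace S A} {p pb : KerSpace S A}
    (hπ : π ∈ M.Pi) (hp : p ∈ M.P) :
    M.gradPol r₁ r₂ π p πb pb = gradient (fun x => M.J x p) π + r₁ • (π - πb) := by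
  refine HasGradientAt.gradient ?_
  have h1 := (M.hasGradientAt_J_pol hπ hp).hasFDerivAt.add
    (hasGradientAt_norm_sub_sq πb π r₁).hasFDerivAt
  rw [hasGradientAt_iff_hasFDerivAt, map_add]
  exact h1.sub_const (r₂ / 2 * ‖p - pb‖ ^ 2)

lemma gradKer_eq (M : RMDP S A) {r₁ r₂ : ℝ} {π πb : PolSpace S A} {p pb : KerSpace S A}
    (hπ : π ∈ M.Pi) (hp : p ∈ M.P) :
    M.gradKer r₁ r₂ π p πb pb = gradient (fun y => M.J π y) p - r₂ • (p - pb) := by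
  refine HasGradientAt.gradient ?_
  have h1 := ((M.hasGradientAt_J_ker hπ hp).hasFDerivAt.add_const (r₁ / 2 * ‖π - πb‖ ^ 2)).sub
    (hasGradientAt_norm_sub_sq pb p r₂).hasFDerivAt
  rw [hasGradientAt_iff_hasFDerivAt, map_sub]
  exact h1

end RMDP

/-! ### Optimal values and chosen optimizers expressed through saddle points. -/

namespace SmoothOnProd

variable {E F : Type*} [NormedAddCommGroup E] [InnerProductSpace ℝ E]
  [NormedAddCommGroup F] [InnerProductSpace ℝ F]
variable {X : Set E} {Y : Set F} {f : E → F → ℝ} {gx : E → F → E} {gy : E → F → F} {L M r₁ r₂ : ℝ}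

lemma isMinOn_of_leftOpt (h : SmoothOnProd X Y f gx gy L M) (hr₁ : L ≤ r₁) {x z : E} {y v : F}
    (hy : y ∈ Y) (hx : LeftOpt X gx r₁ x y z) :
    IsMinOn (fun x => regularize f r₁ r₂ x y z v) X x := fun x' hx' => by
  have h1 := h.growth_left (r₂ := r₂) (v := v) hy hx hx'
  have h2 : 0 ≤ (r₁ - L) / 2 * ‖x' - x‖ ^ 2 := mul_nonneg (by linarith) (sq_nonneg _)
  change regularize f r₁ r₂ x y z v ≤ regularize f r₁ r₂ x' y z v
  linarith

lemma isMaxOn_of_rightOpt (h : SmoothOnProd X Y f gx gy L M) (hr₂ : M ≤ r₂) {x z : E} {y v : F}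
    (hx : x ∈ X) (hy : RightOpt Y gy r₂ x y v) :
    IsMaxOn (fun y => regularize f r₁ r₂ x y z v) Y y := fun y' hy' => by
  have h1 := h.growth_right (r₁ := r₁) (z := z) hx hy hy'
  have h2 : 0 ≤ (r₂ - M) / 2 * ‖y' - y‖ ^ 2 := mul_nonneg (by linarith) (sq_nonneg _)
  change regularize f r₁ r₂ x y' z v ≤ regularize f r₁ r₂ x y z v
  linarith

lemma minVal_regularize (h : SmoothOnProd X Y f gx gy L M) (hr₁ : L ≤ r₁) {x z : E} {y v : F}
    (hy : y ∈ Y) (hx : LeftOpt X gx r₁ x y z) :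
    minVal (fun x => regularize f r₁ r₂ x y z v) X = regularize f r₁ r₂ x y z v :=
  minVal_eq hx.1 (h.isMinOn_of_leftOpt hr₁ hy hx)

lemma minVal_regularize_le (h : SmoothOnProd X Y f gx gy L M) {x z : E} {y v : F} (hx : x ∈ X)
    (hy : y ∈ Y) :
    minVal (fun x => regularize f r₁ r₂ x y z v) X ≤ regularize f r₁ r₂ x y z v := by
  obtain ⟨w, hw, hmin⟩ := h.exists_isMinOn_left r₁ r₂ z v hy
  rw [minVal_eq hw hmin]
  exact hmin hx

lemma le_maxVal_regularize (h : SmoothOnProd X Y f gx gy L M) {x z : E} {y v : F} (hx : x ∈ X)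
    (hy : y ∈ Y) :
    regularize f r₁ r₂ x y z v ≤ maxVal (fun y => regularize f r₁ r₂ x y z v) Y := by
  obtain ⟨w, hw, hmax⟩ := h.exists_isMaxOn_right r₁ r₂ z v hx
  rw [maxVal_eq hw hmax]
  exact hmax hy

lemma maxVal_minVal_eq (h : SmoothOnProd X Y f gx gy L M) (hr₁ : L ≤ r₁) (hr₂ : M ≤ r₂)
    {x z : E} {y v : F} (hx : LeftOpt X gx r₁ x y z) (hy : RightOpt Y gy r₂ x y v) :
    maxVal (fun y => minVal (fun x => regularize f r₁ r₂ x y z v) X) Y =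
      regularize f r₁ r₂ x y z v := by
  rw [← h.minVal_regularize hr₁ hy.1 hx]
  refine maxVal_eq (f := fun y => minVal (fun x => regularize f r₁ r₂ x y z v) X) hy.1
    fun y' hy' => ?_
  change minVal _ _ ≤ minVal _ _
  rw [h.minVal_regularize hr₁ hy.1 hx]
  exact (h.minVal_regularize_le hx.1 hy').trans (h.isMaxOn_of_rightOpt hr₂ hx.1 hy hy')

lemma isMinOn_maxVal (h : SmoothOnProd X Y f gx gy L M) (hr₁ : L ≤ r₁) (hr₂ : M ≤ r₂)
    {x z : E} {y v : F} (hx : LeftOpt X gx r₁ x y z) (hy : RightOpt Y gy r₂ x y v) :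
    IsMinOn (fun x => maxVal (fun y => regularize f r₁ r₂ x y z v) Y) X x := fun x' hx' => by
  change maxVal _ _ ≤ maxVal _ _
  rw [maxVal_eq hy.1 (h.isMaxOn_of_rightOpt (z := z) hr₂ hx.1 hy)]
  exact (h.isMinOn_of_leftOpt hr₁ hy.1 hx hx').trans (h.le_maxVal_regularize hx' hy.1)

lemma minVal_maxVal_eq (h : SmoothOnProd X Y f gx gy L M) (hr₁ : L ≤ r₁) (hr₂ : M ≤ r₂)
    {x z : E} {y v : F} (hx : LeftOpt X gx r₁ x y z) (hy : RightOpt Y gy r₂ x y v) :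
    minVal (fun x => maxVal (fun y => regularize f r₁ r₂ x y z v) Y) X =
      regularize f r₁ r₂ x y z v := by
  rw [minVal_eq hx.1 (h.isMinOn_maxVal hr₁ hr₂ hx hy),
    maxVal_eq hy.1 (h.isMaxOn_of_rightOpt hr₂ hx.1 hy)]

lemma argminOn_leftOpt (h : SmoothOnProd X Y f gx gy L M) (r₁ r₂ : ℝ) (z : E) {y : F} (v : F)
    (hy : y ∈ Y) :
    LeftOpt X gx r₁ (argminOn (fun x => regularize f r₁ r₂ x y z v) X) y z := by
  have := argminOn_spec (h.exists_isMinOn_left r₁ r₂ z v hy)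
  exact h.leftOpt_of_isMinOn this.1 hy this.2

/-- Quadratic growth at the saddle point makes the minimizer unique, so the arbitrary choice made by
`argminOn` is harmless. -/
lemma argminOn_maxVal_eq (h : SmoothOnProd X Y f gx gy L M) (hr₁ : L < r₁) (hr₂ : M ≤ r₂)
    {x z : E} {y v : F} (hx : LeftOpt X gx r₁ x y z) (hy : RightOpt Y gy r₂ x y v) :
    argminOn (fun x => maxVal (fun y => regularize f r₁ r₂ x y z v) Y) X = x := by
  obtain ⟨h1, h2⟩ := argminOn_spec ⟨x, hx.1, h.isMinOn_maxVal hr₁.le hr₂ hx hy⟩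
  set x' := argminOn (fun x => maxVal (fun y => regularize f r₁ r₂ x y z v) Y) X
  have h3 : maxVal (fun y => regularize f r₁ r₂ x' y z v) Y ≤
      maxVal (fun y => regularize f r₁ r₂ x y z v) Y := h2 hx.1
  rw [maxVal_eq hy.1 (h.isMaxOn_of_rightOpt (z := z) hr₂ hx.1 hy)] at h3
  have h4 := h.growth_left (r₂ := r₂) (v := v) hy.1 hx h1
  have h5 := h.le_maxVal_regularize (r₁ := r₁) (r₂ := r₂) (z := z) (v := v) h1 hy.1
  have h6 : (r₁ - L) / 2 * ‖x' - x‖ ^ 2 ≤ 0 := by linarith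
  have h7 : ‖x' - x‖ ^ 2 ≤ 0 := nonpos_of_mul_nonpos_right h6 (by linarith)
  exact sub_eq_zero.mp (norm_eq_zero.mp (pow_eq_zero_iff two_ne_zero |>.mp
    (le_antisymm h7 (sq_nonneg _))))

lemma argmaxOn_eq (h : SmoothOnProd X Y f gx gy L M) (hr₂ : M < r₂)
    {x z : E} {y v : F} (hx : x ∈ X) (hy : RightOpt Y gy r₂ x y v) :
    argmaxOn (fun y => regularize f r₁ r₂ x y z v) Y = y := by
  obtain ⟨h1, h2⟩ := argmaxOn_spec (h.exists_isMaxOn_right r₁ r₂ z v hx)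
  set y' := argmaxOn (fun y => regularize f r₁ r₂ x y z v) Y
  have h3 : regularize f r₁ r₂ x y z v ≤ regularize f r₁ r₂ x y' z v := h2 hy.1
  have h4 := h.growth_right (r₁ := r₁) (z := z) hx hy h1
  have h6 : (r₂ - M) / 2 * ‖y' - y‖ ^ 2 ≤ 0 := by linarith
  have h7 : ‖y' - y‖ ^ 2 ≤ 0 := nonpos_of_mul_nonpos_right h6 (by linarith)
  exact sub_eq_zero.mp (norm_eq_zero.mp (pow_eq_zero_iff two_ne_zero |>.mp
    (le_antisymm h7 (sq_nonneg _))))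

/-- The saddle value attains its maximum over the dual centre. -/
lemma exists_isMaxOn_centre (h : SmoothOnProd X Y f gx gy L M) (hL : 0 < L) (hr₁ : 2 * L ≤ r₁)
    (hr₂ : M ≤ r₂) (hr₂' : 0 ≤ r₂) (z : E) :
    ∃ q, IsMaxOn (fun v => minVal (fun x => maxVal (fun y => regularize f r₁ r₂ x y z v) Y) X)
      Set.univ q := by
  have hr₁' : L ≤ r₁ := by linarith
  -- The centre ranges over a noncompact space, so the maximizer is sought in `Y`: maximizing over
  -- both `v` and `y` allows v = y, where the penalty vanishes. The values r₂ = 0, v = 0 encode the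
  -- problem without that penalty.
  set m : F → E := fun y => argminOn (fun x => regularize f r₁ 0 x y z 0) X with hmdef
  have hm : ∀ y ∈ Y, LeftOpt X gx r₁ (m y) y z := fun y hy => h.argminOn_leftOpt r₁ 0 z 0 hy
  obtain ⟨q, hq, hmax⟩ := h.compact_right.exists_isMaxOn h.nonempty_right
    (h.continuousOn_value (r₂ := 0) (v := 0) hL hr₁ hm)
  refine ⟨q, fun v _ => ?_⟩
  obtain ⟨x, y, hx, hy⟩ := h.exists_saddle hL hr₁ hr₂ z v
  obtain ⟨x', y', hx', hy'⟩ := h.exists_saddle hL hr₁ hr₂ z q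
  change minVal _ _ ≤ minVal _ _
  rw [h.minVal_maxVal_eq hr₁' hr₂ hx hy, h.minVal_maxVal_eq hr₁' hr₂ hx' hy']
  have h1 : regularize f r₁ r₂ x y z v ≤ regularize f r₁ r₂ (m y) y z v :=
    h.isMinOn_of_leftOpt hr₁' hy.1 hx (hm y hy.1).1
  have h2 : regularize f r₁ r₂ (m y) y z v ≤ regularize f r₁ 0 (m y) y z 0 := by
    unfold regularize
    have : 0 ≤ r₂ / 2 * ‖y - v‖ ^ 2 := by positivity
    linarith
  have h3 : regularize f r₁ 0 (m y) y z 0 ≤ regularize f r₁ 0 (m q) q z 0 := hmax hy.1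
  have h4 : regularize f r₁ 0 (m q) q z 0 = regularize f r₁ r₂ (m q) q z q := by
    simp [regularize]
  have h5 : regularize f r₁ r₂ (m q) q z q ≤ regularize f r₁ r₂ x' q z q :=
    h.isMinOn_of_leftOpt hr₁' hq (hm q hq) hx'.1
  have h6 : regularize f r₁ r₂ x' q z q ≤ regularize f r₁ r₂ x' y' z q :=
    h.isMaxOn_of_rightOpt hr₂ hx'.1 hy' hq
  linarith

end SmoothOnProd

/-! ### From the step-size conditions to the descent of the method. -/

/-- Consequences of admissibility in the form used by the descent estimate. -/
lemma SRPGAdmissible.bounds {L lam r₁ r₂ τ σ β μ : ℝ}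
    (h : SRPGAdmissible L lam r₁ r₂ τ σ β μ) (hL : 0 < L) (hlam : 0 < lam) :
    3 * (L + r₁) ≤ 4 * (1 / τ) ∧ 6 * (lam * L) ≤ 1 / τ ∧
    1 + τ * (L + r₁) ≤ (2 * τ * r₁ + 1) / (τ * (r₁ - L)) * (τ * (r₁ - L)) ∧
    3 * (lam * L * ((2 * τ * r₁ + 1) / (τ * (r₁ - L))) ^ 2) ≤ 2 * (1 / σ) ∧
    6 * (2 * (lam * L) + r₂) ≤ 1 / σ ∧ β ≤ 1 / 100 ∧
    1920 * (r₁ * β) ≤ σ * (lam * L) ^ 2 ∧ μ ≤ 1 / 2 ∧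
    320 * (r₂ * μ) ≤ σ * (lam * L) ^ 2 := by
  obtain ⟨hr₁, hr₂, hτ, hτ', hσ, hσ₁, hσ₂, -, hβ, -, hβ₂, hμ, hμ₁, -, hμ₃⟩ := h
  have hlL : 0 < lam * L := mul_pos hlam hL
  have hr₁0 : 0 < r₁ := by linarith
  have hr₂0 : 0 < r₂ := by linarith [mul_assoc 2 lam L]
  have hsub : 0 < r₁ - L := by linarith
  have hτ₁ := hτ'.trans (min_le_left _ _)
  have hτ₂ := hτ'.trans (min_le_right _ _)
  have hK : 0 < (2 * τ * r₁ + 1) / (τ * (r₁ - L)) := by positivity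
  rw [le_div_iff₀ (by positivity)] at hτ₁ hτ₂ hσ₁ hβ₂ hμ₁ hμ₃
  have hκ : 1 ≤ (lam * L + r₁ - L) / (r₁ - L) := by
    rw [le_div_iff₀ hsub]; linarith
  have hD : 2 * (lam * L) + r₂ ≤ lam * L * ((lam * L + r₁ - L) / (r₁ - L)) + lam * L + r₂ := by
    have := mul_le_mul_of_nonneg_left hκ hlL.le
    linarith
  have hσ₂' : σ * (6 * (2 * (lam * L) + r₂)) ≤ 1 := by
    rw [le_div_iff₀ (by linarith)] at hσ₂
    have := mul_le_mul_of_nonneg_left hD hσ.le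
    linarith
  have hsl : 12 * (σ * (lam * L)) ≤ 1 := by
    have := mul_pos hσ hr₂0
    linarith
  -- This factor 5 turns 384 into 1920; likewise λ + 5 ≥ 5 turns 64 into 320.
  have h5 : 5 ≤ (lam + 5) * (lam + 1) ^ 2 := by nlinarith [sq_nonneg lam, mul_pos hlam hlam]
  refine ⟨?_, ?_, ?_, ?_, ?_, ?_, ?_, ?_, ?_⟩
  · rw [mul_one_div, le_div_iff₀ hτ]; linarith
  · rw [le_div_iff₀ hτ]; linarith
  · rw [div_mul_cancel₀ _ (by positivity)]
    have := mul_le_mul_of_nonneg_left (show L ≤ r₁ by linarith) hτ.le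
    linarith
  · rw [mul_one_div, le_div_iff₀ hσ]; linarith
  · rw [le_div_iff₀ hσ]; linarith
  · have h1 : β * (384 * r₁ * (lam + 5) * (lam + 1) ^ 2) ≤ lam * L / 12 := by
      have := mul_le_mul_of_nonneg_right hsl hlL.le
      linarith
    have h2 : lam * L ≤ (lam + 5) * (lam + 1) ^ 2 * r₁ := by
      have h3 : lam ≤ (lam + 5) * (lam + 1) ^ 2 := by nlinarith [pow_pos hlam 3, pow_pos hlam 2]
      exact mul_le_mul h3 (by linarith) hL.le (by positivity)
    have h4 : 0 < (lam + 5) * (lam + 1) ^ 2 * r₁ := by positivity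
    refine le_of_mul_le_mul_right ?_ h4
    linarith
  · have := mul_le_mul_of_nonneg_left h5 (mul_pos hβ hr₁0).le
    linarith
  · have h1 : 0 ≤ μ * (lam ^ 2 * L ^ 2) := by positivity
    refine le_of_mul_le_mul_right (a := lam + 5) ?_ (by linarith)
    linarith
  · have := mul_pos (mul_pos hμ hr₂0) hlam
    linarith

namespace RMDP

variable {S A : Type*} [Fintype S] [DecidableEq S] [Fintype A]

lemma srpgStep_mem (M : RMDP S A) (r₁ r₂ τ σ β μ : ℝ) (hπ : M.Pi.Nonempty) (hp : M.P.Nonempty)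
    (x : SRPGState S A) :
    (M.srpgStep r₁ r₂ τ σ β μ x).pol ∈ M.Pi ∧ (M.srpgStep r₁ r₂ τ σ β μ x).ker ∈ M.P :=
  ⟨(euclProj_isProj M.convex_Pi M.isCompact_Pi hπ _).1,
    (euclProj_isProj M.convex_P M.isCompact_P hp _).1⟩

lemma srpg_mem (M : RMDP S A) (r₁ r₂ τ σ β μ : ℝ) {π₀ : PolSpace S A} {p₀ : KerSpace S A}
    (hπ : π₀ ∈ M.Pi) (hp : p₀ ∈ M.P) (k : ℕ) :
    (M.srpg r₁ r₂ τ σ β μ π₀ p₀ k).pol ∈ M.Pi ∧ (M.srpg r₁ r₂ τ σ β μ π₀ p₀ k).ker ∈ M.P := by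
  cases k with
  | zero => exact ⟨hπ, hp⟩
  | succ k => exact M.srpgStep_mem r₁ r₂ τ σ β μ ⟨_, hπ⟩ ⟨_, hp⟩ _

/-- One step of the method decreases the Lyapunov function. -/
theorem lyapunov_srpgStep (M : RMDP S A) {L lam r₁ r₂ τ σ β μ : ℝ} (hL : 0 < L) (hlam : 0 < lam)
    (hlip : M.GradLipschitz L (lam * L)) (hadm : SRPGAdmissible L lam r₁ r₂ τ σ β μ)
    {x y : SRPGState S A} (hx : x.pol ∈ M.Pi) (hxk : x.ker ∈ M.P)
    (hy : y = M.srpgStep r₁ r₂ τ σ β μ x) :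
    (M.kerBarArgmax r₁ r₂ y.polBar).Nonempty ∧
      ∀ q ∈ M.kerBarArgmax r₁ r₂ y.polBar,
        M.lyapunov r₁ r₂ x - M.lyapunov r₁ r₂ y ≥
          r₁ / 32 * ‖y.pol - x.pol‖ ^ 2
          + r₂ / 15 * ‖x.ker - M.kerPlus r₁ r₂ σ x.ker x.polBar x.kerBar‖ ^ 2
          + r₁ / (5 * β) * ‖x.polBar - y.polBar‖ ^ 2
          + r₂ / (4 * μ) * ‖M.kerBarPlus r₁ r₂ μ x.kerBar y.polBar - x.kerBar‖ ^ 2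
          - 4 * r₁ * β *
            ‖M.polSaddle r₁ r₂ y.polBar q
              - M.polSaddle r₁ r₂ y.polBar
                  (M.kerBarPlus r₁ r₂ μ x.kerBar y.polBar)‖ ^ 2 := by
  have h := M.smoothOnProd_J hlip ⟨_, hx⟩ ⟨_, hxk⟩
  have hlL : 0 < lam * L := mul_pos hlam hL
  have hr₁ := hadm.r₁_ge
  have hr₂ : 2 * (lam * L) ≤ r₂ := by linarith [hadm.r₂_ge]
  have hr₁' : L < r₁ := by linarith
  have hr₂' : lam * L < r₂ := by linarith
  refine ⟨h.exists_isMaxOn_centre hL hr₁ hr₂'.le (by linarith) y.polBar, fun q hq => ?_⟩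
  obtain ⟨b₁, b₂, b₃, b₄, b₅, b₆, b₇, b₈, b₉⟩ := hadm.bounds hL hlam
  have saddle := h.exists_saddle hL hr₁ hr₂'.le
  -- membership and projections
  have hyp : IsProj M.Pi (x.pol - τ • M.gradPol r₁ r₂ x.pol x.ker x.polBar x.kerBar) y.pol := by
    rw [hy]; exact euclProj_isProj M.convex_Pi M.isCompact_Pi ⟨_, hx⟩ _
  have hyk : IsProj M.P (x.ker + σ • M.gradKer r₁ r₂ y.pol x.ker x.polBar x.kerBar) y.ker := by
    rw [hy]; exact euclProj_isProj M.convex_P M.isCompact_P ⟨_, hxk⟩ _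
  have hyz : y.polBar = x.polBar + β • (y.pol - x.polBar) := by rw [hy]; rfl
  have hyv : y.kerBar = x.kerBar + μ • (y.ker - x.kerBar) := by rw [hy]; rfl
  have hxs : LeftOpt M.Pi (fun π p => gradient (fun x => M.J x p) π) r₁
      (M.polOf r₁ r₂ x.ker x.polBar x.kerBar) x.ker x.polBar :=
    h.argminOn_leftOpt r₁ r₂ x.polBar x.kerBar hxk
  have hys := h.argminOn_leftOpt r₁ r₂ y.polBar y.kerBar hyk.1
  have hplus : IsProj M.P (x.ker + σ • M.gradKer r₁ r₂ (M.polOf r₁ r₂ x.ker x.polBar x.kerBar)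
      x.ker x.polBar x.kerBar) (M.kerPlus r₁ r₂ σ x.ker x.polBar x.kerBar) :=
    euclProj_isProj M.convex_P M.isCompact_P ⟨_, hxk⟩ _
  rw [M.gradPol_eq hx hxk] at hyp
  rw [M.gradKer_eq hyp.1 hxk] at hyk
  rw [M.gradKer_eq hxs.1 hxk] at hplus
  -- saddle points
  obtain ⟨x₁, y₁, hx₁, hy₁⟩ := saddle y.polBar x.kerBar
  have hw : M.kerBarPlus r₁ r₂ μ x.kerBar y.polBar = x.kerBar + μ • (y₁ - x.kerBar) := by
    have e1 : M.polSaddle r₁ r₂ y.polBar x.kerBar = x₁ :=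
      h.argminOn_maxVal_eq hr₁' hr₂'.le hx₁ hy₁
    have e2 : M.kerOf r₁ r₂ x₁ y.polBar x.kerBar = y₁ := h.argmaxOn_eq hr₂' hx₁.1 hy₁
    rw [kerBarPlus, e1, e2]
  obtain ⟨x₂, y₂, hx₂, hy₂⟩ := saddle y.polBar (M.kerBarPlus r₁ r₂ μ x.kerBar y.polBar)
  obtain ⟨x₃, y₃, hx₃, hy₃⟩ := saddle y.polBar q
  obtain ⟨x₄, y₄, hx₄, hy₄⟩ := saddle x.polBar q
  have e₂ : M.polSaddle r₁ r₂ y.polBar (M.kerBarPlus r₁ r₂ μ x.kerBar y.polBar) = x₂ :=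
    h.argminOn_maxVal_eq hr₁' hr₂'.le hx₂ hy₂
  have e₃ : M.polSaddle r₁ r₂ y.polBar q = x₃ := h.argminOn_maxVal_eq hr₁' hr₂'.le hx₃ hy₃
  -- values
  have hswap : ∀ z, (fun v => M.phiPolKer r₁ r₂ z v) =
      fun v => minVal (fun π => M.phiKer r₁ r₂ π z v) M.Pi := fun z => by
    funext v
    obtain ⟨a, b, ha, hb⟩ := saddle z v
    exact (h.maxVal_minVal_eq hr₁'.le hr₂'.le ha hb).trans
      (h.minVal_maxVal_eq hr₁'.le hr₂'.le ha hb).symm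
  have hval : ∀ {z v a b}, LeftOpt M.Pi (fun π p => gradient (fun x => M.J x p) π) r₁ a b z →
      RightOpt M.P (fun π p => gradient (fun y => M.J π y) p) r₂ a b v →
      M.phiPolKer r₁ r₂ z v = regularize M.J r₁ r₂ a b z v := fun ha hb =>
    h.maxVal_minVal_eq hr₁'.le hr₂'.le ha hb
  have hbar_y : M.phiPolKerBar r₁ r₂ y.polBar = regularize M.J r₁ r₂ x₃ y₃ y.polBar q := by
    have hq' : IsMaxOn (fun v => M.phiPolKer r₁ r₂ y.polBar v) Set.univ q := by
      rw [hswap]; exact hq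
    rw [phiPolKerBar, maxVal_eq (Set.mem_univ q) hq', hval hx₃ hy₃]
  -- The same `q`, optimal for the new primal centre, is only a competitor at the old one. The
  -- inequality goes the right way for a lower bound on the decrease.
  have hbar_x : regularize M.J r₁ r₂ x₄ y₄ x.polBar q ≤ M.phiPolKerBar r₁ r₂ x.polBar := by
    obtain ⟨q', hq'⟩ := h.exists_isMaxOn_centre hL hr₁ hr₂'.le (by linarith) x.polBar
    have hq'' : IsMaxOn (fun v => M.phiPolKer r₁ r₂ x.polBar v) Set.univ q' := by
      rw [hswap]; exact hq'
    rw [phiPolKerBar, maxVal_eq (Set.mem_univ q') hq'', ← hval hx₄ hy₄]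
    exact hq'' (Set.mem_univ q)
  have hd_x : M.phiPol r₁ r₂ x.ker x.polBar x.kerBar = _ :=
    h.minVal_regularize (r₂ := r₂) (v := x.kerBar) hr₁'.le hxk hxs
  have hd_y : M.phiPol r₁ r₂ y.ker y.polBar y.kerBar = _ :=
    h.minVal_regularize (r₂ := r₂) (v := y.kerBar) hr₁'.le hyk.1 hys
  have key := h.descent hL hlL hr₁ hr₂ hadm.τ_pos hadm.σ_pos hadm.β_pos hadm.μ_pos b₁ b₂ b₃ b₄ b₅
    b₆ b₇ b₈ b₉ hx hxk hyp hyk hyz hyv hxs hys hplus hx₁ hy₁ hw hx₂ hy₂ hx₃ hy₃ hx₄ hy₄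
  rw [← hd_x, ← hd_y, ← hbar_y] at key
  rw [e₂, e₃]
  have hchi : ∀ π p z v, regularize M.J r₁ r₂ π p z v = M.chi r₁ r₂ π p z v :=
    fun _ _ _ _ => rfl
  rw [hchi x.pol, hchi y.pol] at key
  unfold lyapunov
  linarith

end RMDP

theorem proposition4p1 {S A : Type*} [Fintype S] [DecidableEq S] [Fintype A] (M : RMDP S A) :
    (∃ ℓπp > 0, ∃ ℓpπ > 0, M.GradLipschitz ℓπp ℓpπ) ∧
    ∀ L lam r₁ r₂ τ σ β μ : ℝ, 0 < L → 0 < lam → M.GradLipschitz L (lam * L) →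
      SRPGAdmissible L lam r₁ r₂ τ σ β μ →
      ∀ π₀ ∈ M.Pi, ∀ p₀ ∈ M.P, ∀ k : ℕ,
        let x := M.srpg r₁ r₂ τ σ β μ π₀ p₀ k
        let y := M.srpg r₁ r₂ τ σ β μ π₀ p₀ (k + 1)
        (M.kerBarArgmax r₁ r₂ y.polBar).Nonempty ∧
        ∀ q ∈ M.kerBarArgmax r₁ r₂ y.polBar,
          M.lyapunov r₁ r₂ x - M.lyapunov r₁ r₂ y ≥
            r₁ / 32 * ‖y.pol - x.pol‖ ^ 2
            + r₂ / 15 * ‖x.ker - M.kerPlus r₁ r₂ σ x.ker x.polBar x.kerBar‖ ^ 2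
            + r₁ / (5 * β) * ‖x.polBar - y.polBar‖ ^ 2
            + r₂ / (4 * μ) * ‖M.kerBarPlus r₁ r₂ μ x.kerBar y.polBar - x.kerBar‖ ^ 2
            - 4 * r₁ * β *
              ‖M.polSaddle r₁ r₂ y.polBar q
                - M.polSaddle r₁ r₂ y.polBar
                    (M.kerBarPlus r₁ r₂ μ x.kerBar y.polBar)‖ ^ 2 := by
  refine ⟨M.exists_gradLipschitz, fun L lam r₁ r₂ τ σ β μ hL hlam hlip hadm π₀ hπ₀ p₀ hp₀ k => ?_⟩
  obtain ⟨hx, hxk⟩ := M.srpg_mem r₁ r₂ τ σ β μ hπ₀ hp₀ k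
  exact M.lyapunov_srpgStep hL hlam hlip hadm hx hxk rfl
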